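/- Conventions. A graph $X$ is simplicial (undirected, no loops, no multiple edges), with vertex set $V(X)$ and edge set $E(X)$. It is *fine* if for every edge $e$ and every $n\in\mathbb{N}$ only finitely many circuits (closed paths $(p_0,\dots,p_k=p_0)$ with $k>2$ and $p_0,\dots,p_{k-1}$ distinct) of length at most $n$ contain $e$. It is *hyperbolic* if it is connected and its graph metric is Gromov hyperbolic. For a hyperbolic graph $X$, the Gromov boundary $\partial X$ is the set of geodesic rays $(p_0,p_1,\dots)$ in $X$ modulo finite Hausdorff distance, and $\Delta X=V(X)\sqcup\partial X$. For $a,b\in\Delta X$, a geodesic from $a$ to $b$ is a finite geodesic path, a geodesic ray or a bi-infinite geodesic path with endpoints $a$ and $b$. For $a\in\Delta X$ and $I\subset E(X)$ let $P(a,I)$ be the set of all $b\in\Delta X$ such that no geodesic from $a$ to $b$ has an edge in $I$. The *Bowditch topology* on $\Delta X$ is the topology in which $U$ is open if and only if for every $a\in U$ there is a finite set $I\subset E(X)$ with $P(a,I)\subset U$. An action of a group $G$ on a topological space $M$ is a *convergence action* if $M$ is a compact Hausdorff space with at least three points, $G$ acts by homeomorphisms, and every wandering net $(g_i)$ in $G$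 (i.e. for every $x\in G$, eventually $g_i\ne x$) has a subnet $(g_j)$ for which there are $a,b\in M$, not necessarily distinct, such that for every compact $K\subset M\setminus\{a\}$ and every open $U\ni b$, eventually $g_jK\subset U$. **Proposition.** Let $X$ be a fine hyperbolic graph such that $\Delta X$ has at least three points, and let a group $G$ act on $X$ by graph automorphisms such that $\mathrm{Stab}_G(x)\cap\mathrm{Stab}_G(y)$ is finite for every edge $(x,y)\in E(X)$. Then for every $a\in\Delta X$ the sets $P(a,I)$, with $I\subset E(X)$ finite, form a neighborhood basis of $a$ in the Bowditch topology, and the induced action of $G$ on $\Delta X$ (with $g[(p_0,p_1,\dots)]=[(gp_0,gp_1,\dots)]$ on $\partial X$) is a convergence action. -/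

import Mathlib

open Set Filter Topology

universe u v w

namespace FineGraph

variable {V : Type u}

/-! ### Hyperbolic graphs and fine graphs -/

/-- The Gromov product `(x, y)_z` of vertices, for the graph metric. -/
noncomputable def gromovProduct (X : SimpleGraph V) (x y z : V) : ℝ :=
  ((X.dist x z : ℝ) + (X.dist y z : ℝ) - (X.dist x y : ℝ)) / 2

/-- A hyperbolic graph: connected, and Gromov's four-point condition holds for some `δ`.
The condition is imposed on vertices only. Every point of the geometric realization is within
distance `1 / 2` of a vertex, so this only changes `δ`. -/
structure IsHyperbolic (X : SimpleGraph V) : Prop where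
  connected : X.Connected
  four_point : ∃ δ : ℕ, ∀ x y z t : V,
    min (gromovProduct X x y t) (gromovProduct X y z t) - (δ : ℝ) ≤ gromovProduct X x z t

/-- The circuits of length at most `n` that contain the edge `e`. A circuit is a closed walk of
length at least three without self-intersections apart from its base point, which is
`SimpleGraph.Walk.IsCycle`. -/
def circuits (X : SimpleGraph V) (e : Sym2 V) (n : ℕ) : Set (Σ x : V, X.Walk x x) :=
  {c | c.2.IsCycle ∧ e ∈ c.2.edges ∧ c.2.length ≤ n}

/-- A graph is fine if every edge lies in finitely many circuits of each length. -/
def IsFine (X : SimpleGraph V) : Prop :=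
  ∀ e ∈ X.edgeSet, ∀ n : ℕ, (circuits X e n).Finite

/-! ### Geodesic rays, bi-infinite geodesics, the Gromov boundary -/

/-- A geodesic ray `(p₀, p₁, …)`. -/
@[ext]
structure GeodesicRay (X : SimpleGraph V) where
  toFun : ℕ → V
  adj : ∀ i, X.Adj (toFun i) (toFun (i + 1))
  dist_eq : ∀ i k : ℕ, X.dist (toFun i) (toFun (i + k)) = k

/-- A bi-infinite geodesic path `(…, p₋₁, p₀, p₁, …)`. -/
@[ext]
structure GeodesicLine (X : SimpleGraph V) where
  toFun : ℤ → V
  adj : ∀ i, X.Adj (toFun i) (toFun (i + 1))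
  dist_eq : ∀ (i : ℤ) (k : ℕ), X.dist (toFun i) (toFun (i + k)) = k

/-- The set of edges of a geodesic ray. -/
def GeodesicRay.edges {X : SimpleGraph V} (p : GeodesicRay X) : Set (Sym2 V) :=
  range fun i : ℕ => s(p.toFun i, p.toFun (i + 1))

/-- The set of edges of a bi-infinite geodesic path. -/
def GeodesicLine.edges {X : SimpleGraph V} (p : GeodesicLine X) : Set (Sym2 V) :=
  range fun i : ℤ => s(p.toFun i, p.toFun (i + 1))

/-- The ray `(p₀, p₁, p₂, …)` of a bi-infinite geodesic path. -/
def GeodesicLine.forward {X : SimpleGraph V} (p : GeodesicLine X) : GeodesicRay X where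
  toFun n := p.toFun n
  adj i := by simpa using p.adj i
  dist_eq i k := by simpa using p.dist_eq i k

/-- The ray `(p₀, p₋₁, p₋₂, …)` of a bi-infinite geodesic path. -/
def GeodesicLine.backward {X : SimpleGraph V} (p : GeodesicLine X) : GeodesicRay X where
  toFun n := p.toFun (-(n : ℤ))
  adj i := by
    have h := (p.adj (-((i + 1 : ℕ) : ℤ))).symm
    have e : -((i + 1 : ℕ) : ℤ) + 1 = -(i : ℤ) := by push_cast; ring
    rwa [e] at h
  dist_eq i k := by
    have h := p.dist_eq (-((i + k : ℕ) : ℤ)) k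
    have e : -((i + k : ℕ) : ℤ) + (k : ℤ) = -(i : ℤ) := by push_cast; ring
    rw [e, SimpleGraph.dist_comm] at h
    exact h

/-- Two geodesic rays are equivalent if their Hausdorff distance is finite. -/
def GeodesicRay.Equivalent {X : SimpleGraph V} (p q : GeodesicRay X) : Prop :=
  ∃ r : ℕ, (∀ m, ∃ n, X.edist (p.toFun m) (q.toFun n) ≤ (r : ℕ∞)) ∧
    (∀ n, ∃ m, X.edist (q.toFun n) (p.toFun m) ≤ (r : ℕ∞))

theorem GeodesicRay.Equivalent.trans {X : SimpleGraph V} {p q s : GeodesicRay X}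
    (hpq : p.Equivalent q) (hqs : q.Equivalent s) : p.Equivalent s := by
  obtain ⟨a, ha, ha'⟩ := hpq
  obtain ⟨b, hb, hb'⟩ := hqs
  refine ⟨a + b, fun m => ?_, fun m => ?_⟩
  · obtain ⟨n, hn⟩ := ha m
    obtain ⟨k, hk⟩ := hb n
    refine ⟨k, (SimpleGraph.edist_triangle (v := q.toFun n)).trans ?_⟩
    push_cast
    exact add_le_add hn hk
  · obtain ⟨n, hn⟩ := hb' m
    obtain ⟨k, hk⟩ := ha' n
    refine ⟨k, (SimpleGraph.edist_triangle (v := q.toFun n)).trans ?_⟩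
    push_cast
    rw [add_comm (a : ℕ∞)]
    exact add_le_add hn hk

instance GeodesicRay.setoid (X : SimpleGraph V) : Setoid (GeodesicRay X) where
  r := GeodesicRay.Equivalent
  iseqv :=
    { refl := fun p => ⟨0, fun m => ⟨m, by simp⟩, fun m => ⟨m, by simp⟩⟩
      symm := fun ⟨r, h, h'⟩ => ⟨r, h', h⟩
      trans := GeodesicRay.Equivalent.trans }

/-- The Gromov boundary `∂X`: geodesic rays up to equivalence. -/
def GromovBoundary (X : SimpleGraph V) : Type u := Quotient (GeodesicRay.setoid X)

/-- The boundary point represented by a geodesic ray. -/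
def GeodesicRay.endpoint {X : SimpleGraph V} (p : GeodesicRay X) : GromovBoundary X :=
  Quotient.mk (GeodesicRay.setoid X) p

/-! ### The Bowditch compactification -/

/-- The set `ΔX = V(X) ∪ ∂X` (disjoint union). -/
inductive BowditchCompactification (X : SimpleGraph V) : Type u
  | vertex (x : V) : BowditchCompactification X
  | boundary (ξ : GromovBoundary X) : BowditchCompactification X

open BowditchCompactification

/-- The edge sets `E(p)` of all the geodesics `p` from `a` to `b`, where `a` and `b` are points
of `ΔX`. -/
def geodesicEdgeSets (X : SimpleGraph V) :
    BowditchCompactification X → BowditchCompactification X → Set (Set (Sym2 V))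
  | vertex x, vertex y => {E | ∃ p : X.Walk x y, p.length = X.dist x y ∧ E = {e | e ∈ p.edges}}
  | vertex x, boundary ξ => {E | ∃ p : GeodesicRay X, p.toFun 0 = x ∧ p.endpoint = ξ ∧ E = p.edges}
  | boundary ξ, vertex x => {E | ∃ p : GeodesicRay X, p.toFun 0 = x ∧ p.endpoint = ξ ∧ E = p.edges}
  | boundary ξ, boundary η => {E | ∃ p : GeodesicLine X,
      p.backward.endpoint = ξ ∧ p.forward.endpoint = η ∧ E = p.edges}

/-- `P(a, I)`: the points `b` of `ΔX` such that no geodesic from `a` to `b` has an edge in `I`. -/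
def avoidingSet (X : SimpleGraph V) (a : BowditchCompactification X) (I : Set (Sym2 V)) :
    Set (BowditchCompactification X) :=
  {b | ∀ E ∈ geodesicEdgeSets X a b, Disjoint I E}

theorem avoidingSet_anti (X : SimpleGraph V) (a : BowditchCompactification X)
    {I J : Set (Sym2 V)} (h : I ⊆ J) : avoidingSet X a J ⊆ avoidingSet X a I :=
  fun _ hb E hE => (hb E hE).mono_left h

/-- The Bowditch topology on `ΔX`: a set `U` is open if for every `a ∈ U` there is a finite set
`I` of edges with `P(a, I) ⊆ U`. If there is a topology for which the sets `P(a, I)`, with `I`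
a finite set of edges, form a neighbourhood basis of each point `a`, then it is this one. -/
instance BowditchCompactification.topologicalSpace (X : SimpleGraph V) :
    TopologicalSpace (BowditchCompactification X) where
  IsOpen U := ∀ a ∈ U, ∃ I : Set (Sym2 V), I.Finite ∧ I ⊆ X.edgeSet ∧ avoidingSet X a I ⊆ U
  isOpen_univ := fun _ _ => ⟨∅, finite_empty, empty_subset _, subset_univ _⟩
  isOpen_inter := by
    rintro U U' hU hU' a ⟨ha, ha'⟩
    obtain ⟨I, hI, hIX, hIU⟩ := hU a ha
    obtain ⟨J, hJ, hJX, hJU⟩ := hU' a ha'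
    exact ⟨I ∪ J, hI.union hJ, union_subset hIX hJX,
      subset_inter ((avoidingSet_anti X a subset_union_left).trans hIU)
        ((avoidingSet_anti X a subset_union_right).trans hJU)⟩
  isOpen_sUnion := by
    rintro S hS a ⟨U, hUS, haU⟩
    obtain ⟨I, hI, hIX, hIU⟩ := hS U hUS a haU
    exact ⟨I, hI, hIX, hIU.trans (subset_sUnion_of_mem hUS)⟩

/-! ### Group actions on graphs, and the induced action on `ΔX` -/

/-- The action of `G` on the vertex set is by graph automorphisms. -/
class GraphAction (G : Type v) [Group G] [MulAction G V] (X : SimpleGraph V) : Prop where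
  adj_smul_iff : ∀ (g : G) (x y : V), X.Adj (g • x) (g • y) ↔ X.Adj x y

section Action

variable {G : Type v} [Group G] [MulAction G V] {X : SimpleGraph V} [GraphAction G X]

theorem edist_smul_le (g : G) (x y : V) : X.edist (g • x) (g • y) ≤ X.edist x y := by
  by_cases h : X.edist x y = ⊤
  · rw [h]; exact le_top
  · obtain ⟨p, hp⟩ := SimpleGraph.exists_walk_of_edist_ne_top h
    let f : X →g X := ⟨fun z => g • z, fun {a b} hab => (GraphAction.adj_smul_iff g a b).2 hab⟩
    rw [← hp, ← SimpleGraph.Walk.length_map f p]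
    exact SimpleGraph.edist_le (p.map f)

theorem edist_smul (g : G) (x y : V) : X.edist (g • x) (g • y) = X.edist x y := by
  refine le_antisymm (edist_smul_le g x y) ?_
  simpa using edist_smul_le (X := X) g⁻¹ (g • x) (g • y)

theorem dist_smul (g : G) (x y : V) : X.dist (g • x) (g • y) = X.dist x y :=
  congrArg ENat.toNat (edist_smul g x y)

/-- `g (p₀, p₁, …) = (g p₀, g p₁, …)`. -/
instance : MulAction G (GeodesicRay X) where
  smul g p :=
    { toFun := fun n => g • p.toFun n
      adj := fun i => (GraphAction.adj_smul_iff g _ _).2 (p.adj i)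
      dist_eq := fun i k => by rw [dist_smul, p.dist_eq] }
  one_smul p := GeodesicRay.ext (funext fun n => one_smul G (p.toFun n))
  mul_smul g h p := GeodesicRay.ext (funext fun n => mul_smul g h (p.toFun n))

theorem GeodesicRay.smul_equivalent (g : G) {p q : GeodesicRay X} (h : p.Equivalent q) :
    (g • p).Equivalent (g • q) := by
  obtain ⟨r, h₁, h₂⟩ := h
  refine ⟨r, fun m => ?_, fun m => ?_⟩
  · obtain ⟨n, hn⟩ := h₁ m
    exact ⟨n, (edist_smul_le g _ _).trans hn⟩
  · obtain ⟨n, hn⟩ := h₂ m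
    exact ⟨n, (edist_smul_le g _ _).trans hn⟩

/-- `g [p] = [g p]`. -/
instance : MulAction G (GromovBoundary X) where
  smul g := Quotient.map (fun p : GeodesicRay X => g • p)
    fun _ _ h => GeodesicRay.smul_equivalent g h
  one_smul ξ := Quotient.inductionOn ξ fun p => congrArg GeodesicRay.endpoint (one_smul G p)
  mul_smul g h ξ := Quotient.inductionOn ξ fun p =>
    congrArg GeodesicRay.endpoint (mul_smul g h p)

/-- The induced action on `ΔX = V(X) ∪ ∂X`. -/
instance : MulAction G (BowditchCompactification X) where
  smul g a := match a with
    | vertex x => vertex (g • x)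
    | boundary ξ => boundary (g • ξ)
  one_smul a := match a with
    | vertex x => congrArg vertex (one_smul G x)
    | boundary ξ => congrArg boundary (one_smul G ξ)
  mul_smul g h a := match a with
    | vertex x => congrArg vertex (mul_smul g h x)
    | boundary ξ => congrArg boundary (mul_smul g h ξ)

end Action

/-! ### Convergence actions -/

section Convergence

variable {G : Type v}

/-- A net `(gᵢ)` is wandering if it eventually leaves every point. -/
def IsWandering {I : Type w} [Preorder I] (g : I → G) : Prop :=
  ∀ x : G, ∃ i₀ : I, ∀ i, i₀ ≤ i → g i ≠ x

variable [Group G] {M : Type u} [TopologicalSpace M] [MulAction G M]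

/-- The maps `gᵢ` converge to `b` locally uniformly on `M \ {a}`. -/
def ConvergesLocallyUniformlyOff {I : Type w} [Preorder I] (g : I → G) (a b : M) : Prop :=
  ∀ K : Set M, IsCompact K → K ⊆ {a}ᶜ → ∀ U : Set M, IsOpen U → b ∈ U →
    ∃ i₀ : I, ∀ i, i₀ ≤ i → ∀ x ∈ K, g i • x ∈ U

variable (M) in
/-- A net `(gᵢ)` in `G` is collapsing if there are `a, b ∈ M` (possibly equal) such that the
`gᵢ` converge to `b` locally uniformly on `M \ {a}`. -/
def IsCollapsing {I : Type w} [Preorder I] (g : I → G) : Prop :=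
  ∃ a b : M, ConvergesLocallyUniformlyOff g a b

variable (G M) in
/-- `G` acts on `M` as a convergence action: `M` is a compact Hausdorff space with at least
three points, `G` acts by homeomorphisms, and every wandering net in `G` has a collapsing
subnet. Nets are indexed by directed sets in an arbitrary universe `w`. -/
structure IsConvergenceAction : Prop where
  compactSpace : CompactSpace M
  t2Space : T2Space M
  three_le_card : 3 ≤ ENat.card M
  continuousConstSMul : ContinuousConstSMul G M
  exists_collapsing_subnet :
    ∀ (I : Type w) [Preorder I] [IsDirectedOrder I] [Nonempty I] (g : I → G), IsWandering g →
      ∃ (J : Type w) (_ : Preorder J) (_ : IsDirectedOrder J) (_ : Nonempty J) (φ : J → I),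
        Monotone φ ∧ (∀ i, ∃ j, i ≤ φ j) ∧ IsCollapsing M (g ∘ φ)

end Convergence

end FineGraph

namespace FineGraph

variable {V : Type u} {X : SimpleGraph V}

/-! ### Metric geometry on vertices -/

/-! Two finiteness principles replace local finiteness of the graph. Fineness: from a neighbour of a
vertex `k`, only finitely many neighbours of `k` are reached by walks of bounded length avoiding `k`
(`IsFine.finite_linkClose`). Hyperbolicity: if a geodesic from `b` to `c` avoids `k`, the first
steps from `k` towards `b` and towards `c` are joined by such a walk, of uniformly bounded length
(`IsFirstStep.linkClose_of_joins`).

Convergence is first set up without the topology, as `StronglyConverges`: towards a vertex `v`,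
every fixed neighbour of `v` stops being a first step; towards a boundary point, Gromov products
tend to infinity. Along an ultrafilter, a family with values in a finite set is eventually constant,
so geodesics through a fixed vertex converge pointwise to a geodesic, and their ends converge
strongly to its ends (`exists_joins_limit`). Hence limits exist. They are unique, and geodesics
between points with distinct limits share a vertex, so they too converge after a shift
(`StronglyConverges.exists_joins`). It follows that strong convergence along an ultrafilter means
lying eventually in every `avoidingSet X a I`; these sets are open, and the space is compact
Hausdorff.

For the convergence property, follow a wandering net `g` along an ultrafilter. If some `g i • v` is
eventually a constant `w`, finiteness of edge stabilizers forbids a second such vertex, and `v`, `w`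
serve as repelling and attracting points. Otherwise the limits of `(g i)⁻¹ • x` and `g i • x` serve:
a failure would confine some `g i • u` to the finite set of vertices between two fixed ones
(`exists_attracting_repelling`). -/

theorem dist_triangle_real (hc : X.Connected) (x y z : V) :
    (X.dist x z : ℝ) ≤ X.dist x y + X.dist y z := by
  exact_mod_cast hc.dist_triangle

theorem gromovProduct_comm (x y z : V) : gromovProduct X x y z = gromovProduct X y x z := by
  simp only [gromovProduct, X.dist_comm (u := x) (v := y)]
  ring

theorem gromovProduct_self (x z : V) : gromovProduct X x x z = X.dist x z := by
  simp [gromovProduct]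

theorem gromovProduct_base_change (hc : X.Connected) (x y z t : V) :
    gromovProduct X x y t - X.dist t z ≤ gromovProduct X x y z := by
  have h₁ := dist_triangle_real hc x z t
  have h₂ := dist_triangle_real hc y z t
  rw [X.dist_comm (u := z) (v := t)] at h₁ h₂
  simp only [gromovProduct]
  linarith

theorem gromovProduct_le_dist_left (hc : X.Connected) (x y z : V) :
    gromovProduct X x y z ≤ X.dist x z := by
  have h₁ := dist_triangle_real hc y x z
  rw [X.dist_comm (u := y) (v := x)] at h₁
  simp only [gromovProduct]
  linarith

theorem gromovProduct_le_dist_right (hc : X.Connected) (x y z : V) :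
    gromovProduct X x y z ≤ X.dist y z := by
  rw [gromovProduct_comm]
  exact gromovProduct_le_dist_left hc y x z

/-- Gromov's four-point condition with constant `δ`. -/
def FourPoint (X : SimpleGraph V) (δ : ℕ) : Prop :=
  ∀ x y z t : V,
    min (gromovProduct X x y t) (gromovProduct X y z t) - (δ : ℝ) ≤ gromovProduct X x z t

theorem FourPoint.le {δ : ℕ} (hδ : FourPoint X δ) {x y z t : V} {N : ℝ}
    (hxy : N ≤ gromovProduct X x y t) (hyz : N ≤ gromovProduct X y z t) :
    N - δ ≤ gromovProduct X x z t :=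
  (sub_le_sub_right (le_min hxy hyz) _).trans (hδ x y z t)

theorem exists_vertex_between (hc : X.Connected) (x y : V) {n : ℕ} (hn : n ≤ X.dist x y) :
    ∃ w, X.dist x w = n ∧ n + X.dist w y = X.dist x y := by
  obtain ⟨p, hp⟩ := hc.exists_walk_length_eq_dist x y
  have h₁ := SimpleGraph.dist_le (p.take n)
  have h₂ := SimpleGraph.dist_le (p.drop n)
  have h₃ := hc.dist_triangle (u := x) (v := p.getVert n) (w := y)
  rw [SimpleGraph.Walk.take_length] at h₁
  rw [SimpleGraph.Walk.drop_length] at h₂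
  refine ⟨p.getVert n, ?_, ?_⟩ <;> omega

theorem dist_add_dist_of_mem_support (hc : X.Connected) {x y w : V} (p : X.Walk x y)
    (hp : p.length = X.dist x y) (hw : w ∈ p.support) :
    X.dist x w + X.dist w y = X.dist x y := by
  classical
  have h₁ := SimpleGraph.dist_le (p.takeUntil w hw)
  have h₂ := SimpleGraph.dist_le (p.dropUntil w hw)
  have h₃ := congrArg SimpleGraph.Walk.length (p.take_spec hw)
  rw [SimpleGraph.Walk.length_append] at h₃
  have h₄ := hc.dist_triangle (u := x) (v := w) (w := y)
  omega

/-! ### Link distance at a vertex -/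

/-- The vertices `y` and `z` are joined by a walk of length at most `n` that avoids `k`. -/
def LinkClose (X : SimpleGraph V) (k : V) (n : ℕ) (y z : V) : Prop :=
  ∃ p : X.Walk y z, p.length ≤ n ∧ k ∉ p.support

theorem LinkClose.symm {k y z : V} {n : ℕ} (h : LinkClose X k n y z) : LinkClose X k n z y := by
  obtain ⟨p, hp, hk⟩ := h
  exact ⟨p.reverse, by simpa using hp, by simpa using hk⟩

theorem LinkClose.trans {k y z w : V} {m n : ℕ} (h : LinkClose X k m y z)
    (h' : LinkClose X k n z w) : LinkClose X k (m + n) y w := by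
  obtain ⟨p, hp, hk⟩ := h
  obtain ⟨q, hq, hk'⟩ := h'
  refine ⟨p.append q, ?_, ?_⟩
  · rw [SimpleGraph.Walk.length_append]; omega
  · rw [SimpleGraph.Walk.mem_support_append_iff]; tauto

theorem LinkClose.mono {k y z : V} {m n : ℕ} (h : LinkClose X k m y z) (hmn : m ≤ n) :
    LinkClose X k n y z := by
  obtain ⟨p, hp, hk⟩ := h
  exact ⟨p, hp.trans hmn, hk⟩

theorem LinkClose.refl {k y : V} (h : k ≠ y) (n : ℕ) : LinkClose X k n y y :=
  ⟨.nil, by simp, by simpa using h⟩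

theorem linkClose_of_not_between (hc : X.Connected) {k y z : V}
    (h : X.dist y k + X.dist k z ≠ X.dist y z) : LinkClose X k (X.dist y z) y z := by
  obtain ⟨p, hp⟩ := hc.exists_walk_length_eq_dist y z
  exact ⟨p, hp.le, fun hk => h (dist_add_dist_of_mem_support hc p hp hk)⟩

/-- In a fine graph, balls in the link of a vertex are finite. -/
theorem IsFine.finite_linkClose (hX : IsFine X) {k y : V} (hy : X.Adj k y) (n : ℕ) :
    {z | X.Adj k z ∧ LinkClose X k n y z}.Finite := by
  classical
  -- A path from `y` to `z ≠ y` avoiding `k` closes up through `k` to a circuit with two more edges,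
  -- one of which, `s(k, z)`, determines `z`. The vertex `y` itself is added by hand.
  have hE : (⋃ c ∈ circuits X s(k, y) (n + 2), {e | e ∈ c.2.edges}).Finite :=
    (hX _ hy (n + 2)).biUnion fun c _ => List.finite_toSet _
  have hinj : Function.Injective fun z : V => s(k, z) := fun a b h => Sym2.congr_right.1 h
  refine ((hE.preimage hinj.injOn).union (finite_singleton y)).subset ?_
  rintro z ⟨hz, p, hp, hk⟩
  by_cases hzy : z = y
  · exact Or.inr hzy
  left
  have hk' : k ∉ p.bypass.support := fun h => hk (p.support_bypass_subset_support h)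
  have hpath : (p.bypass.concat hz.symm).IsPath := p.bypass_isPath.concat hk' hz.symm
  have hcyc : (SimpleGraph.Walk.cons hy (p.bypass.concat hz.symm)).IsCycle := by
    rw [SimpleGraph.Walk.cons_isCycle_iff]
    refine ⟨hpath, fun h => ?_⟩
    rw [SimpleGraph.Walk.edges_concat, List.concat_eq_append, List.mem_append] at h
    rcases h with h | h
    · exact hk' (SimpleGraph.Walk.fst_mem_support_of_mem_edges _ h)
    · simp only [List.mem_singleton, Sym2.eq_iff] at h
      rcases h with ⟨h, -⟩ | ⟨-, h⟩
      · exact hz.ne h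
      · exact hzy h.symm
  simp only [mem_preimage, mem_iUnion]
  refine ⟨⟨k, _⟩, ⟨hcyc, by simp, ?_⟩, ?_⟩
  · have := p.length_bypass_le_length
    simp only [SimpleGraph.Walk.length_cons, SimpleGraph.Walk.length_concat]
    omega
  · simp [SimpleGraph.Walk.edges_concat, Sym2.eq_swap (a := z) (b := k)]

/-- The vertex `y` is the first one after `k` on some geodesic from `k` to the vertex `z`. -/
def StepToward (X : SimpleGraph V) (k z y : V) : Prop :=
  X.Adj k y ∧ X.dist k z = X.dist y z + 1

theorem exists_stepToward (hc : X.Connected) {k z : V} (h : k ≠ z) : ∃ y, StepToward X k z y := by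
  obtain ⟨y, h₁, h₂⟩ := exists_vertex_between hc k z (n := 1) (hc.pos_dist_of_ne h)
  exact ⟨y, SimpleGraph.dist_eq_one_iff_adj.1 h₁, by omega⟩

/-- A geodesic from `y` to `z` cannot meet `k`, which is farther from `z` than `y` is. -/
theorem StepToward.linkClose (hc : X.Connected) {k z y : V} (h : StepToward X k z y) :
    LinkClose X k (X.dist k z) y z := by
  refine (linkClose_of_not_between hc ?_).mono (n := X.dist k z) ?_
  · have := h.2
    omega
  · have := h.2
    omega

theorem StepToward.linkClose_of_linkClose (hc : X.Connected) {k z z' y y' : V} {n : ℕ}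
    (h : StepToward X k z y) (h' : StepToward X k z' y') (hz : LinkClose X k n z z') :
    LinkClose X k (X.dist k z + n + X.dist k z') y y' :=
  ((h.linkClose hc).trans hz).trans (h'.linkClose hc).symm

/-- Any two first steps towards `z` are joined through `z` by a walk avoiding `k`, so all lie in one
finite ball of the link. -/
theorem finite_stepToward (hX : IsFine X) (hc : X.Connected) (k z : V) :
    {y | StepToward X k z y}.Finite := by
  by_cases hne : ∃ y, StepToward X k z y
  · obtain ⟨y, hy⟩ := hne
    refine (hX.finite_linkClose hy.1 (X.dist k z + 0 + X.dist k z)).subset fun y' hy' =>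
      ⟨hy'.1, hy.linkClose_of_linkClose hc hy' (.refl ?_ 0)⟩
    rintro rfl
    simpa using hy.2
  · push Not at hne
    simp [hne]

/-- In a connected fine graph, the union of all geodesics between two vertices is finite. -/
theorem finite_between (hX : IsFine X) (hc : X.Connected) (x z : V) :
    {w | X.dist x w + X.dist w z = X.dist x z}.Finite := by
  induction hn : X.dist x z using Nat.strong_induction_on generalizing x with
  | _ n ih =>
    refine ((finite_singleton x).union ((finite_stepToward hX hc x z).biUnion
      (t := fun y => {w | X.dist y w + X.dist w z = X.dist y z}) fun y hy => ?_)).subset ?_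
    · exact ih _ (by have := hy.2; omega) y rfl
    · intro w hw
      by_cases hxw : x = w
      · exact Or.inl hxw.symm
      obtain ⟨y, hy, hy'⟩ := exists_stepToward hc hxw
      have h₁ := hc.dist_triangle (u := y) (v := w) (w := z)
      have h₂ := hc.dist_triangle (u := x) (v := y) (w := z)
      rw [SimpleGraph.dist_eq_one_iff_adj.2 hy] at h₂
      simp only [mem_ofPred_eq] at hw
      refine Or.inr (mem_biUnion (x := y) ⟨hy, ?_⟩ ?_)
      · omega
      · simp only [mem_ofPred_eq]; omega

/-- Take points `a`, `a'` at distance `4 * δ + 1` from `k` on geodesics through `y`, `y'`. Two uses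
of the four-point condition put them within `4 * δ` of each other, too close for a geodesic between
them to pass through `k`. The walk from `y` via `a` and `a'` to `y'` has length at most `(4 * δ + 1)
+ 4 * δ + (4 * δ + 1)`. -/
theorem StepToward.linkClose_of_le_gromovProduct (hc : X.Connected) {δ : ℕ} (hδ : FourPoint X δ)
    {k z z' y y' : V} (h : StepToward X k z y) (h' : StepToward X k z' y')
    (hz : (4 * δ + 1 : ℝ) ≤ gromovProduct X z z' k) : LinkClose X k (12 * δ + 2) y y' := by
  set T := 4 * δ + 1 with hT
  have hT' : (T : ℝ) = 4 * δ + 1 := by rw [hT]; push_cast; ring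
  have hTz : T ≤ X.dist k z := by
    have := gromovProduct_le_dist_left hc z z' k
    rw [X.dist_comm] at this
    exact_mod_cast hT'.trans_le (hz.trans this)
  have hTz' : T ≤ X.dist k z' := by
    have := gromovProduct_le_dist_right hc z z' k
    rw [X.dist_comm] at this
    exact_mod_cast hT'.trans_le (hz.trans this)
  have key : ∀ {z y}, StepToward X k z y → T ≤ X.dist k z →
      ∃ a, X.dist k a = T ∧ StepToward X k a y ∧ (T : ℝ) ≤ gromovProduct X a z k := by
    intro z y h hz
    obtain ⟨a, ha, ha'⟩ := exists_vertex_between hc y z (n := T - 1) (by have := h.2; omega)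
    have h₁ := hc.dist_triangle (u := k) (v := y) (w := a)
    have h₂ := hc.dist_triangle (u := k) (v := a) (w := z)
    have h₃ := h.2
    rw [SimpleGraph.dist_eq_one_iff_adj.2 h.1] at h₁
    have h₄ : X.dist k a = T := by omega
    refine ⟨a, h₄, ⟨h.1, by omega⟩, ?_⟩
    have h₅ : (X.dist k z : ℝ) = T + X.dist a z := by
      have : X.dist k z = T + X.dist a z := by omega
      exact_mod_cast this
    simp only [gromovProduct]
    rw [X.dist_comm (u := a) (v := k), X.dist_comm (u := z) (v := k), h₄, h₅]
    linarith
  obtain ⟨a, ha, hay, haz⟩ := key h hTz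
  obtain ⟨a', ha', hay', haz'⟩ := key h' hTz'
  have h₁ := hδ.le haz (hT'.trans_le hz)
  rw [gromovProduct_comm] at haz'
  have h₂ := hδ.le h₁ ((sub_le_self _ (Nat.cast_nonneg δ)).trans haz')
  have h₃ : (X.dist a a' : ℝ) ≤ 4 * δ := by
    simp only [gromovProduct] at h₂
    rw [X.dist_comm (u := a) (v := k), X.dist_comm (u := a') (v := k), ha, ha'] at h₂
    linarith
  have h₄ : X.dist a a' ≤ 4 * δ := by exact_mod_cast h₃
  refine (hay.linkClose_of_linkClose hc hay' (linkClose_of_not_between hc ?_)).mono ?_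
  · rw [X.dist_comm (u := a) (v := k)]
    omega
  · omega

/-! ### Geodesics parametrized by intervals of integers -/

/-- The map `γ` is a geodesic on the interval `S` of integers. -/
structure IsGeo (X : SimpleGraph V) (S : Set ℤ) (γ : ℤ → V) : Prop where
  ordConnected : S.OrdConnected
  dist_eq : ∀ i ∈ S, ∀ j ∈ S, i ≤ j → (X.dist (γ i) (γ j) : ℤ) = j - i

namespace IsGeo

variable {S : Set ℤ} {γ : ℤ → V}

theorem mem (h : IsGeo X S γ) {i j k : ℤ} (hi : i ∈ S) (hk : k ∈ S) (hij : i ≤ j) (hjk : j ≤ k) :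
    j ∈ S :=
  h.ordConnected.out hi hk ⟨hij, hjk⟩

theorem dist_real (h : IsGeo X S γ) {i j : ℤ} (hi : i ∈ S) (hj : j ∈ S) (hij : i ≤ j) :
    (X.dist (γ i) (γ j) : ℝ) = j - i := by
  exact_mod_cast h.dist_eq i hi j hj hij

theorem reflect (h : IsGeo X S γ) : IsGeo X (Neg.neg ⁻¹' S) (fun i => γ (-i)) where
  ordConnected := ⟨fun i hi j hj k hk => h.mem hj hi (neg_le_neg hk.2) (neg_le_neg hk.1)⟩
  dist_eq i hi j hj hij := by
    rw [X.dist_comm, h.dist_eq _ hj _ hi (neg_le_neg hij)]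
    ring

theorem shift (h : IsGeo X S γ) (t : ℤ) : IsGeo X ((· + t) ⁻¹' S) (fun i => γ (i + t)) where
  ordConnected := ⟨fun i hi j hj k hk => h.mem hi hj (Int.add_le_add_right hk.1 t)
    (Int.add_le_add_right hk.2 t)⟩
  dist_eq i hi j hj hij := by
    rw [h.dist_eq _ hi _ hj (Int.add_le_add_right hij t)]
    ring

theorem restrict (h : IsGeo X S γ) {T : Set ℤ} (hT : T.OrdConnected) : IsGeo X (S ∩ T) γ where
  ordConnected := h.ordConnected.inter hT
  dist_eq i hi j hj hij := h.dist_eq i hi.1 j hj.1 hij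

theorem adj (h : IsGeo X S γ) {i : ℤ} (hi : i ∈ S) (hi' : i + 1 ∈ S) :
    X.Adj (γ i) (γ (i + 1)) := by
  have := h.dist_eq i hi (i + 1) hi' (by omega)
  exact SimpleGraph.dist_eq_one_iff_adj.1 (by omega)

theorem stepToward (h : IsGeo X S γ) {i j : ℤ} (hi : i ∈ S) (hi' : i + 1 ∈ S) (hj : j ∈ S)
    (hij : i + 1 ≤ j) : StepToward X (γ i) (γ j) (γ (i + 1)) := by
  have h₁ := h.dist_eq i hi j hj (by omega)
  have h₂ := h.dist_eq _ hi' j hj hij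
  exact ⟨h.adj hi hi', by omega⟩

theorem linkClose (h : IsGeo X S γ) {k : V} {s : ℤ} (n : ℕ) (hs : s ∈ S) (hs' : s + n ∈ S)
    (hk : ∀ i, s ≤ i → i ≤ s + n → γ i ≠ k) : LinkClose X k n (γ s) (γ (s + n)) := by
  induction n with
  | zero => simpa using LinkClose.refl (hk s le_rfl (by simp)).symm 0
  | succ n ih =>
    have hn : s + n ∈ S := h.mem hs hs' (by omega) (by push_cast; omega)
    have h₁ := ih hn fun i hi hi' => hk i hi (by push_cast; omega)
    push_cast at hs'
    rw [← add_assoc] at hs'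
    have hadj := h.adj hn hs'
    have h₂ : LinkClose X k 1 (γ (s + n)) (γ (s + n + 1)) := by
      refine ⟨hadj.toWalk, by simp, ?_⟩
      have e₁ := hk (s + n) (by omega) (by push_cast; omega)
      have e₂ := hk (s + n + 1) (by omega) (by push_cast; omega)
      simp [e₁.symm, e₂.symm]
    have h₃ := h₁.trans h₂
    push_cast
    rwa [← add_assoc]

/-- If a geodesic stays far from `k`, then the Gromov product of its endpoints is large. -/
theorem le_gromovProduct {δ : ℕ} (hδ : FourPoint X δ) (hc : X.Connected)
    (h : IsGeo X S γ) {k : V} {s s' : ℤ} (hs : s ∈ S) (hs' : s' ∈ S) (hss : s ≤ s') {D : ℝ}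
    (hD : ∀ i, s ≤ i → i ≤ s' → D ≤ X.dist (γ i) k) :
    D - 2 * δ - 1 ≤ gromovProduct X (γ s) (γ s') k := by
  have hL := h.dist_real hs hs' hss
  -- `τ` is the Gromov product of `γ s'` and `k` based at `γ s`, the place where the tripod
  -- branches. At that point of the geodesic, the products at `k` with both endpoints equal half of
  -- `(γ s, γ s')_k` plus half the distance to `k`; rounding `τ` down accounts for the loss of `1`.
  set τ : ℝ := (X.dist (γ s) k + X.dist (γ s) (γ s') - X.dist (γ s') k) / 2 with hτ
  have h₁ := dist_triangle_real hc (γ s') (γ s) k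
  have h₂ := dist_triangle_real hc (γ s) (γ s') k
  rw [X.dist_comm (u := γ s') (v := γ s)] at h₁
  have hτ0 : 0 ≤ τ := by rw [hτ]; linarith
  have hτ1 : τ ≤ s' - s := by rw [hτ]; linarith
  have ht0 : 0 ≤ ⌊τ⌋ := Int.floor_nonneg.2 hτ0
  have ht1 : (⌊τ⌋ : ℝ) ≤ τ := Int.floor_le τ
  have ht2 : τ < ⌊τ⌋ + 1 := Int.lt_floor_add_one τ
  have ht3 : s + ⌊τ⌋ ≤ s' := by
    have : ((s + ⌊τ⌋ : ℤ) : ℝ) ≤ s' := by push_cast; linarith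
    exact_mod_cast this
  have hw := h.mem hs hs' (by omega : s ≤ s + ⌊τ⌋) ht3
  have d₁ := h.dist_real hs hw (by omega)
  have d₂ := h.dist_real hw hs' ht3
  have hD' := hD (s + ⌊τ⌋) (by omega) ht3
  push_cast at d₁ d₂
  have h₄ := hδ (γ s) (γ (s + ⌊τ⌋)) (γ s') k
  have h₅ : (gromovProduct X (γ s) (γ s') k + X.dist (γ (s + ⌊τ⌋)) k - 1) / 2 ≤
      min (gromovProduct X (γ s) (γ (s + ⌊τ⌋)) k) (gromovProduct X (γ (s + ⌊τ⌋)) (γ s') k) := by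
    simp only [gromovProduct]
    refine le_min ?_ ?_ <;> linarith
  linarith

/-- Staying at distance `6 * δ + 2` makes the Gromov product at least `4 * δ + 1` up to the last far
point. From there, one edge of `γ` and two short geodesics to `k` complete the walk. -/
theorem linkClose_of_first_near {δ : ℕ} (hδ : FourPoint X δ) (hc : X.Connected)
    (h : IsGeo X S γ) {k y y' : V} {s s' : ℤ} (hs : s ∈ S) (hs' : s' ∈ S) (hss : s ≤ s')
    (hk : ∀ i, s ≤ i → i ≤ s' → γ i ≠ k)
    (hfar : ∀ i, s ≤ i → i < s' → 6 * δ + 2 ≤ X.dist (γ i) k)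
    (hnear : X.dist (γ s') k < 6 * δ + 2)
    (hy : StepToward X k (γ s) y) (hy' : StepToward X k (γ s') y') :
    LinkClose X k (36 * δ + 12) y y' := by
  rcases hss.eq_or_lt with rfl | hlt
  · refine (hy.linkClose_of_linkClose hc hy' (.refl (hk s le_rfl le_rfl).symm 0)).mono ?_
    rw [X.dist_comm]
    omega
  obtain ⟨t, rfl⟩ : ∃ t, s' = t + 1 := ⟨s' - 1, by ring⟩
  have ht : t ∈ S := h.mem hs hs' (by omega) (by omega)
  obtain ⟨y₁, hy₁⟩ := exists_stepToward hc (hk t (by omega) (by omega)).symm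
  have h₁ : LinkClose X k (12 * δ + 2) y y₁ := by
    refine hy.linkClose_of_le_gromovProduct hc hδ hy₁ ?_
    have := h.le_gromovProduct hδ hc (k := k) (D := 6 * δ + 2) hs ht (by omega)
      fun i hi hi' => by exact_mod_cast hfar i hi (by omega)
    linarith
  have h₂ : LinkClose X k 1 (γ t) (γ (t + 1)) := by
    have := h.linkClose (k := k) 1 ht hs' fun i hi hi' => hk i (by omega) (by simpa using hi')
    simpa using this
  refine (h₁.trans (hy₁.linkClose_of_linkClose hc hy' h₂)).mono ?_
  have h₃ := hc.dist_triangle (u := γ t) (v := γ (t + 1)) (w := k)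
  rw [SimpleGraph.dist_eq_one_iff_adj.2 (h.adj ht hs')] at h₃
  rw [X.dist_comm (u := k) (v := γ t), X.dist_comm (u := k) (v := γ (t + 1))]
  omega

/-- If a geodesic avoids `k`, then the geodesics from `k` to its endpoints start close together
in the link of `k`. -/
theorem linkClose_of_stepToward {δ : ℕ} (hδ : FourPoint X δ) (hc : X.Connected)
    (h : IsGeo X S γ) {k y y' : V} {s s' : ℤ} (hs : s ∈ S) (hs' : s' ∈ S) (hss : s ≤ s')
    (hk : ∀ i, s ≤ i → i ≤ s' → γ i ≠ k)
    (hy : StepToward X k (γ s) y) (hy' : StepToward X k (γ s') y') :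
    LinkClose X k (96 * δ + 32) y y' := by
  by_cases hfar : ∀ i, s ≤ i → i ≤ s' → 6 * δ + 2 ≤ X.dist (γ i) k
  · refine (hy.linkClose_of_le_gromovProduct hc hδ hy' ?_).mono (by omega)
    have := h.le_gromovProduct hδ hc (k := k) (D := 6 * δ + 2) hs hs' hss
      fun i hi hi' => by exact_mod_cast hfar i hi hi'
    linarith
  push Not at hfar
  -- Cut `γ` at its first and last points close to `k`. The outer pieces stay far away until their
  -- inner ends (the second one is read backwards). The middle piece avoids `k` and is short, by the
  -- triangle inequality through `k`, so it serves as a walk itself.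
  let P : ℤ → Prop := fun i => s ≤ i ∧ i ≤ s' ∧ X.dist (γ i) k < 6 * δ + 2
  have hP : ∃ i, P i := hfar
  obtain ⟨a, ⟨ha, ha', had⟩, hamin⟩ := Int.exists_least_of_bdd (P := P) ⟨s, fun i hi => hi.1⟩ hP
  obtain ⟨b, ⟨hb, hb', hbd⟩, hbmax⟩ :=
    Int.exists_greatest_of_bdd (P := P) ⟨s', fun i hi => hi.2.1⟩ hP
  have hab : a ≤ b := hamin b ⟨hb, hb', hbd⟩
  have haS := h.mem hs hs' ha ha'
  have hbS := h.mem hs hs' hb hb'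
  obtain ⟨ya, hya⟩ := exists_stepToward hc (hk a ha ha').symm
  obtain ⟨yb, hyb⟩ := exists_stepToward hc (hk b hb hb').symm
  have h₁ : LinkClose X k (36 * δ + 12) y ya :=
    h.linkClose_of_first_near hδ hc hs haS ha (fun i hi hi' => hk i hi (by omega))
      (fun i hi hi' => by
        by_contra hlt
        have := hamin i ⟨hi, by omega, by omega⟩
        omega) had hy hya
  have h₂ : LinkClose X k (36 * δ + 12) y' yb := by
    refine h.reflect.linkClose_of_first_near hδ hc (s := -s') (s' := -b) (by simpa) (by simpa)
      (by omega) (fun i hi hi' => hk (-i) (by omega) (by omega)) (fun i hi hi' => ?_)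
      (by simpa using hbd) (by simpa using hy') (by simpa using hyb)
    by_contra hlt
    have := hbmax (-i) ⟨by omega, by omega, by omega⟩
    omega
  obtain ⟨n, hn⟩ := Int.eq_ofNat_of_zero_le (sub_nonneg.2 hab)
  obtain rfl : b = a + n := by omega
  have h₃ := h.linkClose (k := k) n haS hbS fun i hi hi' => hk i (by omega) (by omega)
  have h₄ := h.dist_eq a haS _ hbS hab
  have h₅ := hc.dist_triangle (u := γ a) (v := k) (w := γ (a + n))
  rw [X.dist_comm (u := k)] at h₅
  refine ((h₁.trans (hya.linkClose_of_linkClose hc hyb h₃)).trans h₂.symm).mono ?_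
  rw [X.dist_comm (u := k) (v := γ a), X.dist_comm (u := k) (v := γ (a + n))]
  omega

end IsGeo

theorem isGeo_of_walk (hc : X.Connected) {x y : V} (p : X.Walk x y) (hp : p.length = X.dist x y) :
    IsGeo X (Icc 0 (p.length : ℤ)) (fun i => p.getVert i.toNat) where
  ordConnected := ordConnected_Icc
  dist_eq i hi j hj hij := by
    have h₁ := SimpleGraph.dist_le (p.take i.toNat)
    have h₂ := SimpleGraph.dist_le (p.drop j.toNat)
    have h₃ := SimpleGraph.dist_le ((p.drop i.toNat).take (j.toNat - i.toNat))
    rw [SimpleGraph.Walk.take_length] at h₁ h₃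
    rw [SimpleGraph.Walk.drop_length] at h₂
    rw [SimpleGraph.Walk.drop_getVert] at h₃
    have e : i.toNat + (j.toNat - i.toNat) = j.toNat := by omega
    rw [e] at h₃
    have h₄ := hc.dist_triangle (u := x) (v := p.getVert i.toNat) (w := y)
    have h₅ := hc.dist_triangle (u := p.getVert i.toNat) (v := p.getVert j.toNat) (w := y)
    have := hi.1
    have := hj.2
    omega

/-! ### Geodesic rays and their endpoints -/

namespace GeodesicRay

theorem dist_of_le (p : GeodesicRay X) {n m : ℕ} (h : n ≤ m) :
    (X.dist (p.toFun n) (p.toFun m) : ℝ) = m - n := by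
  obtain ⟨k, rfl⟩ := Nat.exists_eq_add_of_le h
  rw [p.dist_eq]
  push_cast
  ring

theorem isGeo (p : GeodesicRay X) : IsGeo X (Ici 0) (fun i => p.toFun i.toNat) where
  ordConnected := ordConnected_Ici
  dist_eq i hi j hj hij := by
    have := mem_Ici.1 hi
    have e : i.toNat + (j.toNat - i.toNat) = j.toNat := by omega
    rw [← e, p.dist_eq]
    omega

theorem dist_abs (p : GeodesicRay X) (n m : ℕ) :
    (X.dist (p.toFun n) (p.toFun m) : ℝ) = |(m : ℝ) - n| := by
  rcases le_total n m with h | h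
  · rw [p.dist_of_le h, abs_of_nonneg]
    exact sub_nonneg.2 (by exact_mod_cast h)
  · rw [X.dist_comm, p.dist_of_le h, abs_of_nonpos]
    · ring
    · exact sub_nonpos.2 (by exact_mod_cast h)

/-- If `p n` is within `r` of `q m`, then `n` and `m` differ by at most `r` plus the distance of the
starting points, so the parameters may be synchronized. -/
theorem endpoint_eq_iff (hc : X.Connected) {p q : GeodesicRay X} :
    p.endpoint = q.endpoint ↔ ∃ C : ℝ, ∀ n, (X.dist (p.toFun n) (q.toFun n) : ℝ) ≤ C := by
  have hed : ∀ x y : V, ∀ r : ℕ, X.edist x y ≤ (r : ℕ∞) ↔ X.dist x y ≤ r := by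
    intro x y r
    rw [← (hc.preconnected x y).coe_dist_eq_edist]
    exact_mod_cast Iff.rfl
  have hq : p.endpoint = q.endpoint ↔ p.Equivalent q := Quotient.eq
  rw [hq]
  constructor
  · rintro ⟨r, h, -⟩
    refine ⟨2 * r + X.dist (p.toFun 0) (q.toFun 0), fun n => ?_⟩
    obtain ⟨m, hm⟩ := h n
    rw [hed] at hm
    have hm' : (X.dist (p.toFun n) (q.toFun m) : ℝ) ≤ r := by exact_mod_cast hm
    have h₁ := dist_triangle_real hc (p.toFun n) (q.toFun m) (q.toFun n)
    have h₂ := dist_triangle_real hc (p.toFun 0) (p.toFun n) (q.toFun m)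
    have h₃ := dist_triangle_real hc (q.toFun 0) (p.toFun 0) (q.toFun m)
    have h₄ := dist_triangle_real hc (p.toFun 0) (q.toFun m) (p.toFun n)
    have h₅ := dist_triangle_real hc (p.toFun 0) (q.toFun 0) (q.toFun m)
    rw [X.dist_comm (u := q.toFun m) (v := p.toFun n)] at h₄
    rw [X.dist_comm (u := q.toFun 0) (v := p.toFun 0)] at h₃
    rw [q.dist_of_le (Nat.zero_le m)] at h₃ h₅
    rw [p.dist_of_le (Nat.zero_le n)] at h₂ h₄
    rw [q.dist_abs] at h₁
    have h₆ : |(n : ℝ) - m| ≤ r + X.dist (p.toFun 0) (q.toFun 0) := by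
      rw [abs_le]
      push_cast at *
      constructor <;> linarith
    linarith
  · rintro ⟨C, hC⟩
    have key : ∀ n, X.dist (p.toFun n) (q.toFun n) ≤ ⌊C⌋₊ := fun n => Nat.le_floor (hC n)
    refine ⟨⌊C⌋₊, fun n => ⟨n, (hed _ _ _).2 (key n)⟩, fun n => ⟨n, (hed _ _ _).2 ?_⟩⟩
    rw [X.dist_comm]
    exact key n

/-- Gromov products along rays with the same endpoint tend to infinity. -/
theorem exists_le_gromovProduct (hc : X.Connected) {p q : GeodesicRay X}
    (h : p.endpoint = q.endpoint) (x : V) :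
    ∃ c : ℝ, ∀ n m : ℕ, min (n : ℝ) m - c ≤ gromovProduct X (p.toFun n) (q.toFun m) x := by
  obtain ⟨C, hC⟩ := (endpoint_eq_iff hc).1 h
  refine ⟨X.dist x (p.toFun 0) + X.dist x (q.toFun 0) + C, fun n m => ?_⟩
  have h₁ := dist_triangle_real hc (p.toFun n) (p.toFun m) (q.toFun m)
  have h₂ := dist_triangle_real hc (p.toFun 0) x (p.toFun n)
  have h₃ := dist_triangle_real hc (q.toFun 0) x (q.toFun m)
  rw [p.dist_of_le (Nat.zero_le n), X.dist_comm (u := p.toFun 0),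
    X.dist_comm (u := x) (v := p.toFun n)] at h₂
  rw [q.dist_of_le (Nat.zero_le m), X.dist_comm (u := q.toFun 0),
    X.dist_comm (u := x) (v := q.toFun m)] at h₃
  rw [p.dist_abs] at h₁
  have hCm := hC m
  have h₄ : (n : ℝ) + m - |(m : ℝ) - n| = 2 * min (n : ℝ) m := by
    rcases le_total (n : ℝ) m with h | h
    · rw [abs_of_nonneg (sub_nonneg.2 h), min_eq_left h]; ring
    · rw [abs_of_nonpos (sub_nonpos.2 h), min_eq_right h]; ring
  have h₅ : (0 : ℝ) ≤ X.dist x (p.toFun 0) := Nat.cast_nonneg _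
  have h₆ : (0 : ℝ) ≤ X.dist x (q.toFun 0) := Nat.cast_nonneg _
  have h₇ : (0 : ℝ) ≤ C := (Nat.cast_nonneg _).trans hCm
  push_cast at h₂ h₃
  simp only [gromovProduct]
  linarith

/-- The four-point condition along `p k`, `p n`, `q m`, `q k` makes the product of `p k` and `q k`
at least `k` minus a constant, so these points stay at bounded distance. -/
theorem endpoint_eq_of_gromovProduct {δ : ℕ} (hδ : FourPoint X δ) (hc : X.Connected)
    {p q : GeodesicRay X} (x : V)
    (h : ∀ N : ℝ, ∃ n m : ℕ, N ≤ gromovProduct X (p.toFun n) (q.toFun m) x) :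
    p.endpoint = q.endpoint := by
  obtain ⟨c, hp⟩ := exists_le_gromovProduct hc (p := p) rfl x
  obtain ⟨c', hq⟩ := exists_le_gromovProduct hc (p := q) rfl x
  rw [endpoint_eq_iff hc]
  refine ⟨X.dist (p.toFun 0) x + X.dist (q.toFun 0) x + 2 * (|c| + |c'| + 2 * δ), fun k => ?_⟩
  -- This bound is large enough to force `k ≤ n` and `k ≤ m`.
  obtain ⟨n, m, hnm⟩ := h (k + X.dist (p.toFun 0) x + X.dist (q.toFun 0) x)
  have g₁ := gromovProduct_le_dist_left hc (p.toFun n) (q.toFun m) x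
  have g₂ := gromovProduct_le_dist_right hc (p.toFun n) (q.toFun m) x
  have h₁ := dist_triangle_real hc (p.toFun n) (p.toFun 0) x
  have h₂ := dist_triangle_real hc (q.toFun m) (q.toFun 0) x
  have d₁ := p.dist_of_le (Nat.zero_le n)
  have d₂ := q.dist_of_le (Nat.zero_le m)
  rw [X.dist_comm] at d₁ d₂
  push_cast at d₁ d₂
  have h₃ : (0 : ℝ) ≤ X.dist (p.toFun 0) x := Nat.cast_nonneg _
  have h₄ : (0 : ℝ) ≤ X.dist (q.toFun 0) x := Nat.cast_nonneg _
  have hkn : (k : ℝ) ≤ n := by linarith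
  have hkm : (k : ℝ) ≤ m := by linarith
  have hδ0 : (0 : ℝ) ≤ δ := Nat.cast_nonneg _
  have hc0 := abs_nonneg c
  have hc0' := abs_nonneg c'
  have hc1 := le_abs_self c
  have hc1' := le_abs_self c'
  have e₁ := hp k n
  have e₂ := hq m k
  rw [min_eq_left hkn] at e₁
  rw [min_eq_right hkm] at e₂
  have e₃ := hδ.le (N := k - |c| - |c'|) (by linarith) (by linarith : _ ≤ _) (x := p.toFun k)
    (y := p.toFun n) (z := q.toFun m) (t := x)
  have e₄ := hδ.le (N := k - |c| - |c'| - δ) e₃ (by linarith) (z := q.toFun k)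
  have h₅ := dist_triangle_real hc (p.toFun k) (p.toFun 0) x
  have h₆ := dist_triangle_real hc (q.toFun k) (q.toFun 0) x
  have d₃ := p.dist_of_le (Nat.zero_le k)
  have d₄ := q.dist_of_le (Nat.zero_le k)
  rw [X.dist_comm] at d₃ d₄
  push_cast at d₃ d₄
  simp only [gromovProduct] at e₄
  linarith

end GeodesicRay

open BowditchCompactification

/-! ### Ends of geodesics -/

/-- The geodesic `γ` on `S` ends, in positive direction, at the point `b` of `ΔX`. -/
def PosEnd (X : SimpleGraph V) (S : Set ℤ) (γ : ℤ → V) : BowditchCompactification X → Prop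
  | vertex y => ∃ m, IsGreatest S m ∧ γ m = y
  | boundary ξ => ∃ p : GeodesicRay X, p.endpoint = ξ ∧
      ∃ s : ℤ, ∀ n : ℕ, s + n ∈ S ∧ γ (s + n) = p.toFun n

/-- The geodesic `γ` on `S` ends, in negative direction, at the point `a` of `ΔX`. -/
def NegEnd (X : SimpleGraph V) (S : Set ℤ) (γ : ℤ → V) (a : BowditchCompactification X) : Prop :=
  PosEnd X (Neg.neg ⁻¹' S) (fun i => γ (-i)) a

/-- The map `γ` is a geodesic on `S` from `a` to `b`. -/
structure Joins (X : SimpleGraph V) (S : Set ℤ) (γ : ℤ → V) (a b : BowditchCompactification X) :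
    Prop extends IsGeo X S γ where
  negEnd : NegEnd X S γ a
  posEnd : PosEnd X S γ b

theorem PosEnd.shift {S : Set ℤ} {γ : ℤ → V} {b : BowditchCompactification X}
    (h : PosEnd X S γ b) (t : ℤ) : PosEnd X ((· + t) ⁻¹' S) (fun i => γ (i + t)) b := by
  cases b with
  | vertex y =>
    obtain ⟨m, hm, rfl⟩ := h
    refine ⟨m - t, ⟨by simpa using hm.1, fun i hi => ?_⟩, by simp⟩
    have : i + t ≤ m := hm.2 hi
    omega
  | boundary ξ =>
    obtain ⟨p, hp, s, hs⟩ := h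
    refine ⟨p, hp, s - t, fun n => ?_⟩
    have e : s - t + n + t = s + n := by ring
    simpa only [mem_preimage, e] using hs n

theorem NegEnd.shift {S : Set ℤ} {γ : ℤ → V} {a : BowditchCompactification X}
    (h : NegEnd X S γ a) (t : ℤ) : NegEnd X ((· + t) ⁻¹' S) (fun i => γ (i + t)) a := by
  have h' := PosEnd.shift h (-t)
  have e : ∀ i : ℤ, -(i + -t) = -i + t := fun i => by ring
  simp only [e, preimage_preimage] at h'
  simpa only [NegEnd, preimage_preimage] using h'

namespace Joins

variable {S : Set ℤ} {γ : ℤ → V} {a b : BowditchCompactification X}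

theorem shift (h : Joins X S γ a b) (t : ℤ) :
    Joins X ((· + t) ⁻¹' S) (fun i => γ (i + t)) a b :=
  ⟨h.toIsGeo.shift t, h.negEnd.shift t, h.posEnd.shift t⟩

theorem reflect (h : Joins X S γ a b) : Joins X (Neg.neg ⁻¹' S) (fun i => γ (-i)) b a :=
  ⟨h.toIsGeo.reflect, by simpa [NegEnd, preimage_preimage] using h.posEnd, h.negEnd⟩

end Joins

/-- The ray contained in a geodesic that is unbounded in positive direction. -/
def IsGeo.ray {S : Set ℤ} {γ : ℤ → V} (h : IsGeo X S γ) (s : ℤ) (hs : ∀ n : ℕ, s + n ∈ S) :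
    GeodesicRay X where
  toFun n := γ (s + n)
  adj i := by
    have h₁ := hs (i + 1)
    push_cast at h₁ ⊢
    rw [← add_assoc] at h₁ ⊢
    exact h.adj (hs i) h₁
  dist_eq i k := by
    have := h.dist_eq _ (hs i) _ (hs (i + k)) (by push_cast; omega)
    push_cast at this ⊢
    omega

theorem IsGeo.mem_of_not_bddAbove {S : Set ℤ} {γ : ℤ → V} (h : IsGeo X S γ) {s : ℤ} (hs : s ∈ S)
    (hb : ¬BddAbove S) {t : ℤ} (ht : s ≤ t) : t ∈ S := by
  obtain ⟨m, hm, hm'⟩ := not_bddAbove_iff.1 hb t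
  exact h.mem hs hm ht hm'.le

theorem IsGeo.exists_posEnd {S : Set ℤ} {γ : ℤ → V} (h : IsGeo X S γ) (hS : S.Nonempty) :
    ∃ b, PosEnd X S γ b := by
  obtain ⟨s, hs⟩ := hS
  by_cases hb : BddAbove S
  · obtain ⟨m, hm, hmax⟩ := Int.exists_greatest_of_bdd (P := (· ∈ S)) hb ⟨s, hs⟩
    exact ⟨vertex (γ m), m, ⟨hm, fun i hi => hmax i hi⟩, rfl⟩
  · exact ⟨boundary (h.ray s fun n => h.mem_of_not_bddAbove hs hb (by omega)).endpoint,
      _, rfl, s, fun n => ⟨h.mem_of_not_bddAbove hs hb (by omega), rfl⟩⟩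

theorem IsGeo.succ_mem {S : Set ℤ} {γ : ℤ → V} {b : BowditchCompactification X}
    (h : IsGeo X S γ) (hb : PosEnd X S γ b) {i : ℤ} (hi : i ∈ S) (hne : b ≠ vertex (γ i)) :
    i + 1 ∈ S := by
  cases b with
  | vertex z =>
    obtain ⟨j, hj, rfl⟩ := hb
    rcases (hj.2 hi).eq_or_lt with rfl | hlt
    · exact absurd rfl hne
    · exact h.mem hi hj.1 (by omega) hlt
  | boundary ξ =>
    obtain ⟨p, -, s, hs⟩ := hb
    exact h.mem hi (hs ((i + 1 - s).toNat)).1 (by omega) (by omega)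

/-- The filter of vertices that approach the point `b` of `ΔX` along geodesics. -/
def endFilter : BowditchCompactification X → Filter V
  | vertex z => pure z
  | boundary ξ => ⨆ p : {p : GeodesicRay X // p.endpoint = ξ}, map p.1.toFun atTop

instance endFilter_neBot (b : BowditchCompactification X) : (endFilter b).NeBot := by
  cases b with
  | vertex z => exact pure_neBot
  | boundary ξ =>
    obtain ⟨p, hp⟩ := Quotient.exists_rep ξ
    exact iSup_neBot.2 ⟨⟨p, hp⟩, inferInstance⟩

theorem eventually_endFilter_boundary {ξ : GromovBoundary X} {P : V → Prop} :
    (∀ᶠ z in endFilter (boundary ξ), P z) ↔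
      ∀ p : GeodesicRay X, p.endpoint = ξ → ∀ᶠ n in atTop, P (p.toFun n) := by
  simp [endFilter, eventually_iSup]

theorem eventually_endFilter_vertex {x : V} {P : V → Prop} :
    (∀ᶠ z in endFilter (vertex x : BowditchCompactification X), P z) ↔ P x := by
  simp [endFilter]

theorem PosEnd.exists_of_eventually {S : Set ℤ} {γ : ℤ → V} {b : BowditchCompactification X}
    (hb : PosEnd X S γ b) {P : V → Prop} (hP : ∀ᶠ z in endFilter b, P z) {t : ℤ} (ht : t ∈ S) :
    ∃ s ∈ S, t ≤ s ∧ P (γ s) := by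
  cases b with
  | vertex y =>
    obtain ⟨m, hm, rfl⟩ := hb
    exact ⟨m, hm.1, hm.2 ht, eventually_endFilter_vertex.1 hP⟩
  | boundary ξ =>
    obtain ⟨p, hp, s, hs⟩ := hb
    obtain ⟨n, hn, hn'⟩ :=
      ((eventually_endFilter_boundary.1 hP p hp).and (eventually_ge_atTop (t - s).toNat)).exists
    exact ⟨s + n, (hs n).1, by omega, by rwa [(hs n).2]⟩

/-- Replaces the ends of a geodesic by vertices on it, so that estimates for finite geodesics apply
to all kinds of ends at once. -/
theorem Joins.exists_of_eventually {S : Set ℤ} {γ : ℤ → V} {a b : BowditchCompactification X}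
    (h : Joins X S γ a b) {P Q : V → Prop} (hP : ∀ᶠ z in endFilter a, P z)
    (hQ : ∀ᶠ z in endFilter b, Q z) {t : ℤ} (ht : t ∈ S) :
    ∃ s ∈ S, ∃ s' ∈ S, s ≤ t ∧ t ≤ s' ∧ P (γ s) ∧ Q (γ s') := by
  obtain ⟨s', hs', hts', hQ'⟩ := h.posEnd.exists_of_eventually hQ ht
  obtain ⟨s, hs, hts, hP'⟩ := PosEnd.exists_of_eventually h.negEnd hP (t := -t) (by simpa)
  exact ⟨-s, hs, s', hs', by omega, hts', hP', hQ'⟩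

theorem PosEnd.nonempty {S : Set ℤ} {γ : ℤ → V} {b : BowditchCompactification X}
    (hb : PosEnd X S γ b) : S.Nonempty := by
  cases b with
  | vertex y =>
    obtain ⟨m, hm, rfl⟩ := hb
    exact ⟨m, hm.1⟩
  | boundary ξ =>
    obtain ⟨p, hp, s, hs⟩ := hb
    exact ⟨_, (hs 0).1⟩

/-- Along `γ` itself the product is exactly `m - t`; moving to another ray with the same endpoint
costs one `δ`. -/
theorem IsGeo.eventually_le_gromovProduct {δ : ℕ} (hδ : FourPoint X δ) (hc : X.Connected)
    {S : Set ℤ} {γ : ℤ → V} {b : BowditchCompactification X} (h : IsGeo X S γ)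
    (hb : PosEnd X S γ b) {t m : ℤ} (ht : t ∈ S) (hm : m ∈ S) (htm : t ≤ m) :
    ∀ᶠ z in endFilter b, (m - t - δ : ℝ) ≤ gromovProduct X (γ m) z (γ t) := by
  have key : ∀ j ∈ S, m ≤ j → (m - t : ℝ) = gromovProduct X (γ m) (γ j) (γ t) := by
    intro j hj hmj
    have h₁ := h.dist_real ht hm htm
    have h₂ := h.dist_real ht hj (by omega)
    have h₃ := h.dist_real hm hj hmj
    rw [X.dist_comm] at h₁ h₂
    simp only [gromovProduct]
    linarith
  have hδ0 : (0 : ℝ) ≤ δ := Nat.cast_nonneg _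
  cases b with
  | vertex y =>
    obtain ⟨j, hj, rfl⟩ := hb
    rw [eventually_endFilter_vertex, ← key j hj.1 (hj.2 hm)]
    linarith
  | boundary ξ =>
    obtain ⟨p, rfl, s, hs⟩ := hb
    rw [eventually_endFilter_boundary]
    intro q hq
    obtain ⟨c, hc'⟩ := GeodesicRay.exists_le_gromovProduct hc hq.symm (γ t)
    filter_upwards [eventually_ge_atTop ⌈(m - t + c : ℝ)⌉₊] with n hn
    have hn' : (m - t + c : ℝ) ≤ n := Nat.ceil_le.1 hn
    obtain ⟨N, hN⟩ : ∃ N : ℕ, n ≤ N ∧ m ≤ s + N := ⟨n + (m - s).toNat, by omega, by omega⟩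
    have h₁ := key (s + N) (hs N).1 hN.2
    rw [(hs N).2] at h₁
    have h₂ := hc' N n
    have hN' : (n : ℝ) ≤ N := by exact_mod_cast hN.1
    rw [min_eq_right hN'] at h₂
    exact hδ.le h₁.le (by linarith)

/-! ### First steps towards a point of the compactification -/

/-- The vertex `y` is the first one after `k` on some geodesic from `k` to the point `b`. -/
def IsFirstStep (X : SimpleGraph V) (k : V) (b : BowditchCompactification X) (y : V) : Prop :=
  ∃ S γ, IsGeo X S γ ∧ PosEnd X S γ b ∧ 0 ∈ S ∧ 1 ∈ S ∧ γ 0 = k ∧ γ 1 = y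

theorem IsGeo.isFirstStep {S : Set ℤ} {γ : ℤ → V} {b : BowditchCompactification X}
    (h : IsGeo X S γ) (hb : PosEnd X S γ b) {i : ℤ} (hi : i ∈ S) (hi' : i + 1 ∈ S) :
    IsFirstStep X (γ i) b (γ (i + 1)) :=
  ⟨_, _, h.shift i, hb.shift i, by simpa, by simpa [add_comm] using hi', by simp,
    by simp [add_comm]⟩

theorem IsFirstStep.adj {k y : V} {b : BowditchCompactification X} (h : IsFirstStep X k b y) :
    X.Adj k y := by
  obtain ⟨S, γ, h, -, h0, h1, rfl, rfl⟩ := h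
  exact h.adj (i := 0) h0 h1

theorem IsFirstStep.stepToward {k y z : V} (h : IsFirstStep X k (vertex z) y) :
    StepToward X k z y := by
  obtain ⟨S, γ, h, ⟨m, hm, rfl⟩, h0, h1, rfl, rfl⟩ := h
  exact h.stepToward (i := 0) h0 h1 hm.1 (hm.2 h1)

theorem not_isFirstStep_self {k y : V} : ¬IsFirstStep X k (vertex k) y := fun h => by
  simpa using h.stepToward.2

theorem joins_of_walk (hc : X.Connected) {x y : V} (p : X.Walk x y)
    (hp : p.length = X.dist x y) :
    Joins X (Icc 0 (p.length : ℤ)) (fun i => p.getVert i.toNat) (vertex x) (vertex y) := by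
  refine ⟨isGeo_of_walk hc p hp, ⟨0, ⟨by simp, fun i hi => ?_⟩, by simp⟩,
    ⟨p.length, ⟨by simp, fun i hi => hi.2⟩, by simp⟩⟩
  have : 0 ≤ -i := hi.1
  omega

theorem IsFirstStep.eventually_linkClose {δ : ℕ} (hδ : FourPoint X δ) (hc : X.Connected)
    {k y : V} {b : BowditchCompactification X} (h : IsFirstStep X k b y) :
    ∀ᶠ z in endFilter b, k ≠ z ∧ ∀ y', StepToward X k z y' → LinkClose X k (12 * δ + 2) y y' := by
  by_cases hb : ∃ z, b = vertex z
  · obtain ⟨z, rfl⟩ := hb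
    rw [eventually_endFilter_vertex]
    have hkz : k ≠ z := by
      rintro rfl
      exact not_isFirstStep_self h
    refine ⟨hkz, fun y' hy' => ?_⟩
    by_cases hd : 4 * δ + 1 ≤ X.dist k z
    · refine h.stepToward.linkClose_of_le_gromovProduct hc hδ hy' ?_
      rw [gromovProduct_self, X.dist_comm]
      exact_mod_cast hd
    · exact (h.stepToward.linkClose_of_linkClose hc hy' (.refl hkz 0)).mono (by omega)
  · obtain ⟨S, γ, h, he, h0, h1, rfl, rfl⟩ := h
    cases b with
    | vertex z => exact absurd ⟨z, rfl⟩ hb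
    | boundary ξ =>
      have hmem : ∀ n : ℕ, (n : ℤ) ∈ S := by
        intro n
        obtain ⟨p, -, s, hs⟩ := he
        exact h.mem h0 (hs (n + s.natAbs)).1 (by omega) (by omega)
      -- After the loss of `δ` this leaves `4 * δ + 1`, the threshold of
      -- `StepToward.linkClose_of_le_gromovProduct`.
      have hT := hmem (5 * δ + 1)
      filter_upwards [h.eventually_le_gromovProduct hδ hc he h0 hT (by omega)] with z hz
      push_cast at hz
      have hz' : (4 * δ + 1 : ℝ) ≤ gromovProduct X (γ ((5 * δ + 1 : ℕ) : ℤ)) z (γ 0) := by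
        push_cast
        linarith
      refine ⟨?_, fun y' hy' => StepToward.linkClose_of_le_gromovProduct hc hδ
        (h.stepToward (i := 0) h0 h1 hT (by push_cast; omega)) hy' hz'⟩
      rintro rfl
      have h₁ := gromovProduct_le_dist_right hc (γ ((5 * δ + 1 : ℕ) : ℤ)) (γ 0) (γ 0)
      have h₂ : (0 : ℝ) ≤ δ := Nat.cast_nonneg _
      rw [SimpleGraph.dist_self] at h₁
      push_cast at h₁ hz'
      linarith

/-- The geodesics from a vertex `k` to a point `b` start close together in the link of `k`. -/
theorem IsFirstStep.linkClose {δ : ℕ} (hδ : FourPoint X δ) (hc : X.Connected)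
    {k y y' : V} {b : BowditchCompactification X} (h : IsFirstStep X k b y)
    (h' : IsFirstStep X k b y') : LinkClose X k (24 * δ + 4) y y' := by
  obtain ⟨z, ⟨hkz, hz⟩, -, hz'⟩ :=
    ((h.eventually_linkClose hδ hc).and (h'.eventually_linkClose hδ hc)).exists
  obtain ⟨w, hw⟩ := exists_stepToward hc hkz
  exact ((hz w hw).trans (hz' w hw).symm).mono (by omega)

/-- If some geodesic from `b` to `c` avoids `k`, then the geodesics from `k` to `b` and to `c`
start close together in the link of `k`. -/
theorem IsFirstStep.linkClose_of_joins {δ : ℕ} (hδ : FourPoint X δ) (hc : X.Connected)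
    {k y y' : V} {b c : BowditchCompactification X} (h : IsFirstStep X k b y)
    (h' : IsFirstStep X k c y') {S : Set ℤ} {γ : ℤ → V} (hγ : Joins X S γ b c)
    (hk : ∀ i ∈ S, γ i ≠ k) : LinkClose X k (120 * δ + 36) y y' := by
  obtain ⟨t, ht⟩ := hγ.posEnd.nonempty
  obtain ⟨s, hs, s', hs', hst, hts, ⟨h₁, h₂⟩, h₃, h₄⟩ := hγ.exists_of_eventually
    (h.eventually_linkClose hδ hc) (h'.eventually_linkClose hδ hc) ht
  obtain ⟨w, hw⟩ := exists_stepToward hc h₁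
  obtain ⟨w', hw'⟩ := exists_stepToward hc h₃
  refine (((h₂ w hw).trans (hγ.toIsGeo.linkClose_of_stepToward hδ hc hs hs' (hst.trans hts)
    (fun i hi hi' => hk i (hγ.mem hs hs' hi hi')) hw hw')).trans (h₄ w' hw').symm).mono (by omega)

/-! ### Strong convergence -/

/-- Convergence of points of `ΔX`, expressed by first steps at a vertex and by Gromov products at
a boundary point. -/
def StronglyConverges {ι : Type*} (l : Filter ι) (c : ι → BowditchCompactification X) :
    BowditchCompactification X → Prop
  | vertex v => ∀ y, ∀ᶠ i in l, ¬IsFirstStep X v (c i) y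
  | boundary ξ => ∀ p : GeodesicRay X, p.endpoint = ξ → ∀ (N : ℝ) (x : V),
      ∀ᶠ i in l, ∀ᶠ z in endFilter (c i), ∀ᶠ n in atTop, N ≤ gromovProduct X (p.toFun n) z x

theorem StronglyConverges.congr {ι : Type*} {l : Filter ι} {c d : ι → BowditchCompactification X}
    {a : BowditchCompactification X} (h : StronglyConverges l c a) (hcd : ∀ᶠ i in l, c i = d i) :
    StronglyConverges l d a := by
  cases a with
  | vertex v =>
    intro y
    filter_upwards [h y, hcd] with i hi e
    rwa [← e]
  | boundary ξ =>
    intro p hp N x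
    filter_upwards [h p hp N x, hcd] with i hi e
    rwa [← e]

theorem stronglyConverges_const {ι : Type*} (hc : X.Connected) (l : Filter ι)
    (a : BowditchCompactification X) : StronglyConverges l (fun _ => a) a := by
  cases a with
  | vertex v => exact fun y => Eventually.of_forall fun i => not_isFirstStep_self
  | boundary ξ =>
    intro p hp N x
    refine Eventually.of_forall fun i => eventually_endFilter_boundary.2 fun q hq => ?_
    obtain ⟨c, hc'⟩ := GeodesicRay.exists_le_gromovProduct hc (hp.trans hq.symm) x
    filter_upwards [eventually_ge_atTop ⌈N + c⌉₊] with m hm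
    filter_upwards [eventually_ge_atTop ⌈N + c⌉₊] with n hn
    have := hc' n m
    have : N + c ≤ min (n : ℝ) m := le_min (Nat.ceil_le.1 hn) (Nat.ceil_le.1 hm)
    linarith

theorem GeodesicRay.stronglyConverges (hc : X.Connected) (p : GeodesicRay X) :
    StronglyConverges atTop (fun n => vertex (p.toFun n)) (boundary p.endpoint) := by
  intro q hq N x
  have := stronglyConverges_const hc (⊤ : Filter Unit) (boundary p.endpoint) q hq N x
  have := (eventually_top.1 this) ()
  filter_upwards [eventually_endFilter_boundary.1 this p rfl] with n hn
  exact eventually_endFilter_vertex.2 hn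

theorem StronglyConverges.mono {ι : Type*} {l l' : Filter ι} {c : ι → BowditchCompactification X}
    {a : BowditchCompactification X} (h : StronglyConverges l c a) (hl : l' ≤ l) :
    StronglyConverges l' c a := by
  cases a with
  | vertex v => exact fun y => hl (h y)
  | boundary ξ => exact fun p hp N x => hl (h p hp N x)

/-- If `σ` stops at `v` while some `y` remains a first step from `v` towards `b i`, then the next
vertices of the `γ i` lie in a finite link ball around `y`, hence are eventually constant, and `σ`
would continue. If `σ` never stops, the `γ i` agree with it at `0` and at a point as far out as
desired, which makes the Gromov products large. -/
theorem exists_posEnd_limit (hX : IsFine X) (hh : IsHyperbolic X) {ι : Type*} (l : Ultrafilter ι)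
    {b : ι → BowditchCompactification X} {S : ι → Set ℤ} {γ : ι → ℤ → V}
    (hγ : ∀ᶠ i in l, IsGeo X (S i) (γ i)) (hb : ∀ᶠ i in l, PosEnd X (S i) (γ i) (b i))
    {T : Set ℤ} {σ : ℤ → V} (hσ : IsGeo X T σ) (h0 : 0 ∈ T)
    (hTσ : ∀ n v, (n ∈ T ∧ σ n = v) ↔ ∀ᶠ i in l, n ∈ S i ∧ γ i n = v) :
    ∃ b', PosEnd X T σ b' ∧ StronglyConverges l b b' := by
  obtain ⟨hc, δ, hδ⟩ := hh
  obtain ⟨b', hb'⟩ := hσ.exists_posEnd ⟨0, h0⟩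
  refine ⟨b', hb', ?_⟩
  cases b' with
  | vertex v =>
    intro y
    obtain ⟨m, hm, rfl⟩ := hb'
    rw [Ultrafilter.eventually_not]
    intro hy
    have hm' := (hTσ m (σ m)).1 ⟨hm.1, rfl⟩
    have hstep : ∀ᶠ i in l, m + 1 ∈ S i ∧ IsFirstStep X (σ m) (b i) (γ i (m + 1)) := by
      filter_upwards [hγ, hb, hm', hy] with i hγi hbi hmi hyi
      have hmem : m + 1 ∈ S i := by
        refine hγi.succ_mem hbi hmi.1 ?_
        rintro e
        rw [e, hmi.2] at hyi
        exact not_isFirstStep_self hyi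
      refine ⟨hmem, ?_⟩
      have := hγi.isFirstStep hbi hmi.1 hmem
      rwa [hmi.2] at this
    obtain ⟨i₀, hi₀⟩ := hy.exists
    obtain ⟨v, -, hv⟩ := (Ultrafilter.eventually_exists_mem_iff
      (P := fun v i => γ i (m + 1) = v) (hX.finite_linkClose hi₀.adj (24 * δ + 4))).1 (by
        filter_upwards [hstep, hy] with i hi hyi
        exact ⟨_, ⟨hi.2.adj, hyi.linkClose hδ hc hi.2⟩, rfl⟩)
    have := hm.2 ((hTσ (m + 1) v).2 (by filter_upwards [hstep, hv] with i hi hv using ⟨hi.1, hv⟩)).1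
    omega
  | boundary ξ =>
    intro p hp N x
    obtain ⟨q, rfl, s, hs⟩ := hb'
    obtain ⟨c, hc'⟩ := GeodesicRay.exists_le_gromovProduct hc hp x
    -- The first entry pays for passing from `q` to `p`, the second for moving the base point from
    -- `σ 0` to `x`.
    set M := max (N + δ + c) (N + 2 * δ + X.dist (σ 0) x - s) with hM
    obtain ⟨n₀, hn₀, hn₀'⟩ : ∃ n : ℕ, M ≤ n ∧ 0 ≤ s + n :=
      ⟨⌈M⌉₊ + s.natAbs, (Nat.le_ceil M).trans (by push_cast; simp), by omega⟩
    have h₁ := (le_max_left _ _).trans hn₀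
    have h₂ := (le_max_right _ _).trans hn₀
    filter_upwards [hγ, hb, (hTσ 0 _).1 ⟨h0, rfl⟩, (hTσ (s + n₀) _).1 ⟨(hs n₀).1, rfl⟩] with
      i hγi hbi h0i hmi
    filter_upwards [hγi.eventually_le_gromovProduct hδ hc hbi h0i.1 hmi.1 hn₀'] with z hz
    rw [h0i.2, hmi.2, (hs n₀).2] at hz
    push_cast at hz
    have hz' := gromovProduct_base_change hc (q.toFun n₀) z x (σ 0)
    filter_upwards [eventually_ge_atTop n₀] with n hn
    have hn' : (n₀ : ℝ) ≤ n := by exact_mod_cast hn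
    have h₃ := hc' n n₀
    rw [min_eq_right hn'] at h₃
    have h₄ := FourPoint.le hδ (N := N + δ) (by linarith : _ ≤ _)
      (by linarith : _ ≤ gromovProduct X (q.toFun n₀) z x) (x := p.toFun n)
    linarith

/-- The pointwise limit along the ultrafilter. It exists on an interval, since only finitely many
vertices lie between two given ones. The negative end is treated by reversing the geodesics. -/
theorem exists_joins_limit (hX : IsFine X) (hh : IsHyperbolic X) {ι : Type*} (l : Ultrafilter ι)
    {a b : ι → BowditchCompactification X} {S : ι → Set ℤ} {γ : ι → ℤ → V} {u : V}
    (hγ : ∀ᶠ i in l, Joins X (S i) (γ i) (a i) (b i))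
    (hu : ∀ᶠ i in l, 0 ∈ S i ∧ γ i 0 = u) :
    ∃ a' b' T σ, Joins X T σ a' b' ∧ StronglyConverges l a a' ∧ StronglyConverges l b b' ∧
      ∀ n v, (n ∈ T ∧ σ n = v) ↔ ∀ᶠ i in l, n ∈ S i ∧ γ i n = v := by
  classical
  have hc := hh.connected
  let T : Set ℤ := {n | ∃ v, ∀ᶠ i in l, n ∈ S i ∧ γ i n = v}
  let σ : ℤ → V := fun n => if h : n ∈ T then h.choose else u
  have hspec : ∀ n ∈ T, ∀ᶠ i in l, n ∈ S i ∧ γ i n = σ n := by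
    intro n hn
    simp only [σ, dif_pos hn]
    exact hn.choose_spec
  have hTσ : ∀ n v, (n ∈ T ∧ σ n = v) ↔ ∀ᶠ i in l, n ∈ S i ∧ γ i n = v := by
    intro n v
    constructor
    · rintro ⟨hn, rfl⟩
      exact hspec n hn
    · intro h
      have hn : n ∈ T := ⟨v, h⟩
      obtain ⟨i, hi, hi'⟩ := (h.and (hspec n hn)).exists
      exact ⟨hn, hi'.2.symm.trans hi.2⟩
  have h0 : 0 ∈ T := ⟨u, hu⟩
  have hσ : IsGeo X T σ := by
    refine ⟨⟨fun n hn m hm j hj => ?_⟩, fun n hn m hm hnm => ?_⟩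
    · obtain ⟨v, -, hv⟩ := (Ultrafilter.eventually_exists_mem_iff
        (P := fun v i => γ i j = v) (finite_between hX hc (σ n) (σ m))).1 (by
          filter_upwards [hγ, hspec n hn, hspec m hm] with i hγi hni hmi
          have hji := hγi.mem hni.1 hmi.1 hj.1 hj.2
          have h₁ := hγi.dist_eq n hni.1 j hji hj.1
          have h₂ := hγi.dist_eq j hji m hmi.1 hj.2
          have h₃ := hγi.dist_eq n hni.1 m hmi.1 (hj.1.trans hj.2)
          refine ⟨_, ?_, rfl⟩
          rw [← hni.2, ← hmi.2]
          omega)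
      refine ⟨v, ?_⟩
      filter_upwards [hγ, hspec n hn, hspec m hm, hv] with i hγi hni hmi hvi
      exact ⟨hγi.mem hni.1 hmi.1 hj.1 hj.2, hvi⟩
    · obtain ⟨i, hγi, hni, hmi⟩ := (hγ.and ((hspec n hn).and (hspec m hm))).exists
      rw [← hni.2, ← hmi.2, hγi.dist_eq n hni.1 m hmi.1 hnm]
  obtain ⟨b', hb', hlb⟩ := exists_posEnd_limit hX hh l (hγ.mono fun i h => h.toIsGeo)
    (hγ.mono fun i h => h.posEnd) hσ h0 hTσ
  obtain ⟨a', ha', hla⟩ := exists_posEnd_limit hX hh l (hγ.mono fun i h => h.toIsGeo.reflect)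
    (hγ.mono fun i h => h.negEnd) hσ.reflect (by simpa) (fun n v => by
      simpa using hTσ (-n) v)
  exact ⟨a', b', T, σ, ⟨hσ, ha', hb'⟩, hla, hlb, hTσ⟩

/-! ### Uniqueness of limits and existence of geodesics -/

theorem GeodesicRay.endpoint_tail (hc : X.Connected) (p q : GeodesicRay X) (k : ℕ)
    (h : ∀ n, q.toFun n = p.toFun (n + k)) : q.endpoint = p.endpoint := by
  rw [GeodesicRay.endpoint_eq_iff hc]
  refine ⟨k, fun n => ?_⟩
  rw [h, X.dist_comm, p.dist_eq]

theorem NegEnd.exists_eq {S : Set ℤ} {γ : ℤ → V} {v : V} (h : NegEnd X S γ (vertex v)) :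
    ∃ n ∈ S, γ n = v := by
  obtain ⟨m, hm, hm'⟩ := h
  exact ⟨-m, hm.1, hm'⟩

theorem PosEnd.restrict_Ici (hc : X.Connected) {S : Set ℤ} {γ : ℤ → V} (hγ : IsGeo X S γ)
    {b : BowditchCompactification X}
    (h : PosEnd X S γ b) {n : ℤ} (hn : n ∈ S) : PosEnd X (S ∩ Ici n) γ b := by
  cases b with
  | vertex y =>
    obtain ⟨m, hm, rfl⟩ := h
    exact ⟨m, ⟨⟨hm.1, hm.2 hn⟩, fun i hi => hm.2 hi.1⟩, rfl⟩
  | boundary ξ =>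
    obtain ⟨p, rfl, s, hs⟩ := h
    have hs' : ∀ m : ℕ, s + (n - s).toNat + m ∈ S := fun m => by
      have := (hs ((n - s).toNat + m)).1
      push_cast at this
      rwa [← add_assoc] at this
    refine ⟨hγ.ray _ hs', GeodesicRay.endpoint_tail hc _ _ (n - s).toNat fun m => ?_,
      s + (n - s).toNat, fun m => ⟨⟨hs' m, ?_⟩, rfl⟩⟩
    · rw [← (hs _).2]
      change γ _ = γ _
      congr 1
      push_cast
      ring
    · simp only [mem_Ici]
      omega

theorem Joins.restrict_Ici (hc : X.Connected) {S : Set ℤ} {γ : ℤ → V}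
    {a b : BowditchCompactification X} (h : Joins X S γ a b) {n : ℤ} (hn : n ∈ S) :
    Joins X (S ∩ Ici n) γ (vertex (γ n)) b := by
  refine ⟨h.toIsGeo.restrict ordConnected_Ici, ⟨-n, ⟨?_, fun i hi => ?_⟩, by simp⟩,
    h.posEnd.restrict_Ici hc h.toIsGeo hn⟩
  · simpa using hn
  · have : n ≤ -i := hi.2
    omega

/-- A vertex far out on a ray to `ξ` has some first step `y₀` from `v`. Large Gromov products keep
the first steps towards `c i` in a fixed link ball around `y₀`. -/
theorem StronglyConverges.exists_finite_firstStep (hX : IsFine X) (hh : IsHyperbolic X)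
    {ι : Type*} {l : Filter ι} {c : ι → BowditchCompactification X} {ξ : GromovBoundary X}
    (h : StronglyConverges l c (boundary ξ)) (v : V) :
    ∃ Y : Set V, Y.Finite ∧ ∀ᶠ i in l, ∀ y, IsFirstStep X v (c i) y → y ∈ Y := by
  obtain ⟨hc, δ, hδ⟩ := hh
  obtain ⟨p, hp⟩ := Quotient.exists_rep ξ
  obtain ⟨C, hC⟩ := GeodesicRay.exists_le_gromovProduct hc (p := p) rfl v
  set N : ℝ := 5 * δ + 1 with hN
  obtain ⟨n₀, hn₀⟩ := exists_nat_ge (N + C)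
  have hfar : ∀ n ≥ n₀, N ≤ gromovProduct X (p.toFun n₀) (p.toFun n) v := by
    intro n hn
    have h₁ := hC n₀ n
    have h₂ : (n₀ : ℝ) ≤ n := by exact_mod_cast hn
    rw [min_eq_left h₂] at h₁
    linarith
  have hδ0 : (0 : ℝ) ≤ δ := Nat.cast_nonneg _
  have hne : v ≠ p.toFun n₀ := by
    intro e
    have h₁ := hfar n₀ le_rfl
    rw [gromovProduct_self, ← e, SimpleGraph.dist_self] at h₁
    push_cast at h₁
    linarith
  obtain ⟨y₀, hy₀⟩ := exists_stepToward hc hne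
  refine ⟨_, hX.finite_linkClose hy₀.1 (24 * δ + 4), ?_⟩
  filter_upwards [h p hp N v] with i hi y hy
  obtain ⟨z, hz, hkz, hyz⟩ := (hi.and (hy.eventually_linkClose hδ hc)).exists
  obtain ⟨n, hn, hn'⟩ := (hz.and (eventually_ge_atTop n₀)).exists
  obtain ⟨y', hy'⟩ := exists_stepToward hc hkz
  have h₁ := FourPoint.le hδ (hfar n hn') hn
  refine ⟨hy.adj, LinkClose.mono ((hy₀.linkClose_of_le_gromovProduct hc hδ hy' ?_).trans
    (hyz y' hy').symm) (by omega)⟩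
  linarith

theorem StronglyConverges.boundary_unique (hh : IsHyperbolic X)
    {ι : Type*} {l : Filter ι} [l.NeBot] {c : ι → BowditchCompactification X}
    {ξ η : GromovBoundary X} (h : StronglyConverges l c (boundary ξ))
    (h' : StronglyConverges l c (boundary η)) : ξ = η := by
  obtain ⟨hc, δ, hδ⟩ := hh
  obtain ⟨p, rfl⟩ := Quotient.exists_rep ξ
  obtain ⟨q, rfl⟩ := Quotient.exists_rep η
  refine GeodesicRay.endpoint_eq_of_gromovProduct hδ hc (p.toFun 0) fun N => ?_
  obtain ⟨i, hi, hi'⟩ :=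
    ((h p rfl (N + δ) (p.toFun 0)).and (h' q rfl (N + δ) (p.toFun 0))).exists
  obtain ⟨z, hz, hz'⟩ := (hi.and hi').exists
  obtain ⟨n, hn⟩ := hz.exists
  obtain ⟨m, hm⟩ := hz'.exists
  rw [gromovProduct_comm] at hm
  exact ⟨n, m, by linarith [FourPoint.le hδ hn hm]⟩

/-- Convergence to `ξ` confines the first steps from `v` to a finite set, so one of them persists
along the ultrafilter, which convergence to `v` forbids. Existence of first steps is assumed because
for boundary points it is itself derived from this lemma. -/
theorem StronglyConverges.not_vertex_of_boundary (hX : IsFine X) (hh : IsHyperbolic X)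
    {ι : Type*} {l : Ultrafilter ι} {c : ι → BowditchCompactification X} {ξ : GromovBoundary X}
    {v : V} (h : StronglyConverges l c (boundary ξ))
    (hne : ∀ᶠ i in l, c i ≠ vertex v → ∃ y, IsFirstStep X v (c i) y) :
    ¬StronglyConverges l c (vertex v) := by
  intro h'
  have hcv : ∀ᶠ i in l, c i ≠ vertex v := by
    rw [Ultrafilter.eventually_not]
    intro hcv
    obtain ⟨p, rfl⟩ := Quotient.exists_rep ξ
    obtain ⟨i, hi, hi'⟩ := ((h p rfl 1 v).and hcv).exists
    rw [hi', eventually_endFilter_vertex] at hi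
    obtain ⟨n, hn⟩ := hi.exists
    have := gromovProduct_le_dist_right hh.connected (p.toFun n) v v
    rw [SimpleGraph.dist_self] at this
    push_cast at this
    linarith
  obtain ⟨Y, hY, hY'⟩ := h.exists_finite_firstStep hX hh v
  obtain ⟨y, -, hy⟩ := (Ultrafilter.eventually_exists_mem_iff
    (P := fun y i => IsFirstStep X v (c i) y) hY).1 (by
      filter_upwards [hY', hcv, hne] with i h₁ h₂ h₃
      obtain ⟨y, hy⟩ := h₃ h₂
      exact ⟨y, h₁ y hy, hy⟩)
  obtain ⟨i, hi, hi'⟩ := (hy.and (h' y)).exists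
  exact hi' hi

theorem exists_joins_vertex_vertex (hc : X.Connected) (x y : V) :
    ∃ S γ, Joins X S γ (vertex x) (vertex y) ∧ IsLeast S 0 ∧ γ 0 = x := by
  obtain ⟨p, hp⟩ := hc.exists_walk_length_eq_dist x y
  exact ⟨_, _, joins_of_walk hc p hp, ⟨by simp, fun i hi => hi.1⟩, by simp⟩

theorem Joins.exists_isFirstStep {S : Set ℤ} {γ : ℤ → V} {k : V} {b : BowditchCompactification X}
    (h : Joins X S γ (vertex k) b) (hb : b ≠ vertex k) : ∃ y, IsFirstStep X k b y := by
  obtain ⟨n, hn, rfl⟩ := h.negEnd.exists_eq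
  exact ⟨_, h.toIsGeo.isFirstStep h.posEnd hn (h.toIsGeo.succ_mem h.posEnd hn hb)⟩

/-- For a boundary point, take the limit of geodesics from `k` to the vertices of a ray. Its end is
a limit of these vertices, hence cannot be a vertex or another boundary point. -/
theorem exists_joins_vertex (hX : IsFine X) (hh : IsHyperbolic X) (k : V)
    (b : BowditchCompactification X) :
    ∃ S γ, Joins X S γ (vertex k) b ∧ IsLeast S 0 ∧ γ 0 = k := by
  have hc := hh.connected
  cases b with
  | vertex z => exact exists_joins_vertex_vertex hc k z
  | boundary ξ =>
    obtain ⟨p, rfl⟩ := Quotient.exists_rep ξ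
    have hlim := (p.stronglyConverges hc).mono Nat.hyperfilter_le_atTop
    choose S γ hγ hS h0 using fun i => exists_joins_vertex_vertex hc k (p.toFun i)
    obtain ⟨a', b', T, σ, hσ, ha, hb, hT⟩ := exists_joins_limit hX hh (hyperfilter ℕ)
      (u := k) (Eventually.of_forall hγ) (Eventually.of_forall fun i => ⟨(hS i).1, h0 i⟩)
    have hT0 : 0 ∈ T ∧ σ 0 = k :=
      (hT 0 k).2 (Eventually.of_forall fun i => ⟨(hS i).1, h0 i⟩)
    have hleast : IsLeast T 0 := by
      refine ⟨hT0.1, fun n hn => ?_⟩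
      obtain ⟨i, hi⟩ := ((hT n _).1 ⟨hn, rfl⟩).exists
      exact (hS i).2 hi.1
    have hb' : b' = boundary p.endpoint := by
      cases b' with
      | vertex v =>
        refine absurd hb (hlim.not_vertex_of_boundary hX hh (Eventually.of_forall fun i hi => ?_))
        obtain ⟨S', γ', h, -, -⟩ := exists_joins_vertex_vertex hc v (p.toFun i)
        exact Joins.exists_isFirstStep h hi
      | boundary η => rw [hb.boundary_unique hh hlim]
    rw [hb'] at hσ
    refine ⟨T, σ, ⟨hσ.toIsGeo, ⟨0, ⟨by simpa using hT0.1, fun i hi => ?_⟩, by simpa using hT0.2⟩,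
      hσ.posEnd⟩, hleast, hT0.2⟩
    have := hleast.2 hi
    omega

theorem exists_isFirstStep (hX : IsFine X) (hh : IsHyperbolic X) {k : V}
    {b : BowditchCompactification X} (hb : b ≠ vertex k) : ∃ y, IsFirstStep X k b y := by
  obtain ⟨S, γ, h, -, -⟩ := exists_joins_vertex hX hh k b
  exact Joins.exists_isFirstStep h hb

/-- If `aᵢ` converges to the vertex `v` and `bᵢ` does not, then geodesics from `aᵢ` to `bᵢ`
pass through `v`. -/
theorem StronglyConverges.eventually_exists_eq (hX : IsFine X) (hh : IsHyperbolic X)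
    {ι : Type*} {l : Ultrafilter ι} {a b : ι → BowditchCompactification X} {v : V}
    (ha : StronglyConverges l a (vertex v)) (hb : ¬StronglyConverges l b (vertex v))
    {S : ι → Set ℤ} {γ : ι → ℤ → V} (hγ : ∀ᶠ i in l, Joins X (S i) (γ i) (a i) (b i)) :
    ∀ᶠ i in l, ∃ n ∈ S i, γ i n = v := by
  by_contra hcon
  rw [← Ultrafilter.eventually_not] at hcon
  simp only [StronglyConverges, not_forall, Ultrafilter.eventually_not, not_not] at hb
  obtain ⟨y, hy⟩ := hb
  obtain ⟨i₀, hi₀⟩ := hy.exists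
  obtain ⟨hc, δ, hδ⟩ := id hh
  -- Here `y` is a persistent first step towards `b i`. If `v` is avoided, the first steps towards
  -- `a i` lie in a finite link ball around `y`, so one of them persists, against `ha`.
  obtain ⟨y', -, hy'⟩ := (Ultrafilter.eventually_exists_mem_iff
    (P := fun y i => IsFirstStep X v (a i) y)
    (hX.finite_linkClose hi₀.adj (120 * δ + 36))).1 (by
      filter_upwards [hcon, hy, hγ] with i h₁ h₂ h₃
      push Not at h₁
      have hne : a i ≠ vertex v := by
        intro e
        rw [e] at h₃
        obtain ⟨n, hn, hn'⟩ := h₃.negEnd.exists_eq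
        exact h₁ n hn hn'
      obtain ⟨y', hy'⟩ := exists_isFirstStep hX hh hne
      exact ⟨y', ⟨hy'.adj, h₂.linkClose_of_joins hδ hc hy' h₃.reflect
        fun n hn => h₁ (-n) hn⟩, hy'⟩)
  obtain ⟨i, hi, hi'⟩ := (hy'.and (ha y')).exists
  exact hi' hi

theorem not_stronglyConverges_const_vertex (hX : IsFine X) (hh : IsHyperbolic X) {ι : Type*}
    {l : Filter ι} [l.NeBot] {b : BowditchCompactification X} {v : V} (h : b ≠ vertex v) :
    ¬StronglyConverges l (fun _ => b) (vertex v) := by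
  intro h'
  obtain ⟨y, hy⟩ := exists_isFirstStep hX hh h
  obtain ⟨i, hi⟩ := (h' y).exists
  exact hi hy

/-- For distinct vertices `v`, `v'`, geodesics from `v'` to `c i` pass through `v`, because `c i`
tends to `v` and `v'` does not. They then leave `v'` by one of the finitely many first steps towards
`v`, so `c i` does not tend to `v'`. -/
theorem StronglyConverges.unique (hX : IsFine X) (hh : IsHyperbolic X)
    {ι : Type*} {l : Ultrafilter ι} {c a b : _} (ha : StronglyConverges (X := X) (l : Filter ι) c a)
    (hb : StronglyConverges (l : Filter ι) c b) : a = b := by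
  have hne : ∀ v, ∀ᶠ i in l, c i ≠ vertex v → ∃ y, IsFirstStep X v (c i) y :=
    fun v => Eventually.of_forall fun i hi => exists_isFirstStep hX hh hi
  cases a with
  | vertex v =>
    cases b with
    | vertex v' =>
      by_contra hvv
      choose S γ hγ hS h0 using fun i => exists_joins_vertex hX hh v' (c i)
      have h₁ := ha.eventually_exists_eq hX hh (not_stronglyConverges_const_vertex hX hh
        (Ne.symm hvv)) (Eventually.of_forall fun i => (hγ i).reflect)
      have hv' : v' ≠ v := fun e => hvv (by rw [e])
      obtain ⟨y, -, hy⟩ := (Ultrafilter.eventually_exists_mem_iff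
        (P := fun y i => IsFirstStep X v' (c i) y)
        (finite_stepToward hX hh.connected v' v)).1 (by
          filter_upwards [h₁] with i hi
          obtain ⟨n, hn, hn'⟩ := hi
          have h₂ : 0 ≤ -n := (hS i).2 hn
          have h₃ : -n ≠ 0 := by
            rintro e
            rw [e, h0] at hn'
            exact hv' hn'
          have h₄ := (hγ i).mem (hS i).1 hn (by omega : (0 : ℤ) ≤ 0 + 1) (by omega)
          have h₅ := (hγ i).toIsGeo.stepToward (hS i).1 h₄ hn (by omega)
          have h₆ := (hγ i).toIsGeo.isFirstStep (hγ i).posEnd (hS i).1 h₄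
          rw [h0] at h₅ h₆
          rw [hn'] at h₅
          exact ⟨_, h₅, h₆⟩)
      obtain ⟨i, hi, hi'⟩ := (hy.and (hb y)).exists
      exact hi' hi
    | boundary η => exact absurd ha (hb.not_vertex_of_boundary hX hh (hne v))
  | boundary ξ =>
    cases b with
    | vertex v' => exact absurd hb (ha.not_vertex_of_boundary hX hh (hne v'))
    | boundary η => rw [ha.boundary_unique hh hb]

/-- The compactness statement: geodesics from a base point to `c i` have a limit geodesic, and its
end is the limit. -/
theorem exists_stronglyConverges (hX : IsFine X) (hh : IsHyperbolic X) {ι : Type*}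
    (l : Ultrafilter ι) (c : ι → BowditchCompactification X) : ∃ a, StronglyConverges l c a := by
  obtain ⟨x⟩ := hh.connected.nonempty
  choose S γ hγ hS h0 using fun i => exists_joins_vertex hX hh x (c i)
  obtain ⟨a', b', T, σ, hσ, ha, hb, hT⟩ := exists_joins_limit hX hh l
    (u := x) (Eventually.of_forall hγ) (Eventually.of_forall fun i => ⟨(hS i).1, h0 i⟩)
  exact ⟨b', hb⟩

/-! ### Limits of geodesics -/

theorem StronglyConverges.exists_near (hh : IsHyperbolic X)
    {ι : Type*} {l : Filter ι} {a b : ι → BowditchCompactification X} {ξ η : GromovBoundary X}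
    (ha : StronglyConverges l a (boundary ξ)) (hb : StronglyConverges l b (boundary η))
    (hne : ξ ≠ η) {S : ι → Set ℤ} {γ : ι → ℤ → V}
    (hγ : ∀ᶠ i in l, Joins X (S i) (γ i) (a i) (b i)) (x : V) :
    ∃ R : ℝ, ∀ᶠ i in l, ∃ n ∈ S i, (X.dist (γ i n) x : ℝ) ≤ R := by
  obtain ⟨hc, δ, hδ⟩ := hh
  obtain ⟨p, rfl⟩ := Quotient.exists_rep ξ
  obtain ⟨q, rfl⟩ := Quotient.exists_rep η
  have hpq := mt (GeodesicRay.endpoint_eq_of_gromovProduct hδ hc (p := p) (q := q) x) hne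
  push Not at hpq
  obtain ⟨B, hB⟩ := hpq
  -- A geodesic farther from `x` than this has endpoints with product at least `B + 2 * δ`. Two
  -- four-point steps to the rays `p` and `q` would then give a product of at least `B`.
  refine ⟨B + 4 * δ + 1, ?_⟩
  filter_upwards [hγ, ha p rfl (B + 2 * δ) x, hb q rfl (B + 2 * δ) x] with i hγi hai hbi
  by_contra hcon
  push Not at hcon
  obtain ⟨t, ht⟩ := hγi.posEnd.nonempty
  obtain ⟨s, hs, s', hs', hst, hts, h₁, h₂⟩ := hγi.exists_of_eventually hai hbi ht
  obtain ⟨n, hn⟩ := h₁.exists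
  obtain ⟨m, hm⟩ := h₂.exists
  have h₃ := hγi.toIsGeo.le_gromovProduct hδ hc hs hs' (hst.trans hts) (k := x)
    fun j hj hj' => (hcon j (hγi.mem hs hs' hj hj')).le
  have hδ0 : (0 : ℝ) ≤ δ := Nat.cast_nonneg _
  have h₄ := FourPoint.le hδ hn (by linarith : _ ≤ gromovProduct X (γ i s) (γ i s') x)
  rw [gromovProduct_comm] at hm
  have h₅ := FourPoint.le hδ h₄ (by linarith : _ ≤ gromovProduct X (γ i s') (q.toFun m) x)
  have h₆ := hB n m
  linarith

/-- Geodesics between points that converge to different limits pass through a common vertex. -/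
theorem StronglyConverges.exists_common_vertex (hX : IsFine X) (hh : IsHyperbolic X)
    {ι : Type*} {l : Ultrafilter ι} {a b : ι → BowditchCompactification X} {a' b' : _}
    (ha : StronglyConverges l a a') (hb : StronglyConverges l b b')
    (hne : a' ≠ b') {S : ι → Set ℤ} {γ : ι → ℤ → V}
    (hγ : ∀ᶠ i in l, Joins X (S i) (γ i) (a i) (b i)) :
    ∃ u, ∀ᶠ i in l, ∃ n ∈ S i, γ i n = u := by
  have hc := hh.connected
  cases a' with
  | vertex v =>
    exact ⟨v, ha.eventually_exists_eq hX hh (fun h => hne (h.unique hX hh hb)) hγ⟩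
  | boundary ξ =>
    cases b' with
    | vertex v =>
      refine ⟨v, ?_⟩
      filter_upwards [hb.eventually_exists_eq hX hh (fun h => hne (ha.unique hX hh h))
        (hγ.mono fun i h => h.reflect)] with i hi
      obtain ⟨n, hn, hn'⟩ := hi
      exact ⟨-n, hn, hn'⟩
    | boundary η =>
      obtain ⟨x⟩ := hc.nonempty
      obtain ⟨R, hR⟩ := ha.exists_near hh hb (fun e => hne (by rw [e])) hγ x
      obtain ⟨t, ht⟩ := hR.choice
      -- Balls may be infinite, so the nearby points need not be eventually constant. Being bounded,
      -- they converge to a vertex `v`; the remaining half geodesics run from points tending to `v`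
      -- to points that do not, hence pass through `v`.
      obtain ⟨c, hcl⟩ := exists_stronglyConverges hX hh l fun i => vertex (γ i (t i))
      cases c with
      | boundary ζ =>
        exfalso
        obtain ⟨p, rfl⟩ := Quotient.exists_rep ζ
        obtain ⟨i, hi, hi'⟩ := (ht.and (hcl p rfl (R + 1) x)).exists
        rw [eventually_endFilter_vertex] at hi'
        obtain ⟨n, hn⟩ := hi'.exists
        have := gromovProduct_le_dist_right hc (p.toFun n) (γ i (t i)) x
        linarith [hi.2]
      | vertex v =>
        refine ⟨v, ?_⟩
        have h₁ := hcl.eventually_exists_eq hX hh (b := b) (S := fun i => S i ∩ Ici (t i)) (γ := γ)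
          (fun h => by cases hb.unique hX hh h) (by
            filter_upwards [hγ, ht] with i hγi hti
            exact hγi.restrict_Ici hc hti.1)
        filter_upwards [h₁] with i hi
        obtain ⟨n, hn, hn'⟩ := hi
        exact ⟨n, hn.1, hn'⟩

/-- Geodesics between points that converge to different limits subconverge to a geodesic between
the limits. -/
theorem StronglyConverges.exists_joins (hX : IsFine X) (hh : IsHyperbolic X)
    {ι : Type*} {l : Ultrafilter ι} {a b : ι → BowditchCompactification X} {a' b' : _}
    (ha : StronglyConverges l a a') (hb : StronglyConverges l b b')
    (hne : a' ≠ b') {S : ι → Set ℤ} {γ : ι → ℤ → V}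
    (hγ : ∀ᶠ i in l, Joins X (S i) (γ i) (a i) (b i)) :
    ∃ T σ, Joins X T σ a' b' ∧ ∃ t : ι → ℤ,
      ∀ n ∈ T, ∀ᶠ i in l, n + t i ∈ S i ∧ γ i (n + t i) = σ n := by
  obtain ⟨u, hu⟩ := ha.exists_common_vertex hX hh hb hne hγ
  obtain ⟨t, ht⟩ := hu.choice
  obtain ⟨a'', b'', T, σ, hσ, ha', hb', hT⟩ := exists_joins_limit hX hh l (u := u)
    (hγ.mono fun i h => h.shift (t i)) (by
      filter_upwards [ht] with i hi
      simpa using hi)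
  rw [← ha.unique hX hh ha', ← hb.unique hX hh hb'] at hσ
  exact ⟨T, σ, hσ, t, fun n hn => (hT n _).1 ⟨hn, rfl⟩⟩

theorem exists_joins (hX : IsFine X) (hh : IsHyperbolic X) {a b : BowditchCompactification X}
    (hab : a ≠ b) : ∃ S γ, Joins X S γ a b := by
  cases a with
  | vertex k =>
    obtain ⟨S, γ, h, -⟩ := exists_joins_vertex hX hh k b
    exact ⟨S, γ, h⟩
  | boundary ξ =>
    cases b with
    | vertex k =>
      obtain ⟨S, γ, h, -⟩ := exists_joins_vertex hX hh k (boundary ξ)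
      exact ⟨_, _, h.reflect⟩
    | boundary η =>
      obtain ⟨p, rfl⟩ := Quotient.exists_rep ξ
      obtain ⟨q, rfl⟩ := Quotient.exists_rep η
      have hc := hh.connected
      choose S γ hγ hS h0 using fun i => exists_joins_vertex_vertex hc (p.toFun i) (q.toFun i)
      obtain ⟨T, σ, hσ, -⟩ :=
        ((p.stronglyConverges hc).mono Nat.hyperfilter_le_atTop).exists_joins hX hh
          ((q.stronglyConverges hc).mono Nat.hyperfilter_le_atTop) hab (Eventually.of_forall hγ)
      exact ⟨T, σ, hσ⟩

/-! ### Edges of geodesics -/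

/-- The oriented edge `(x, y)` lies on some geodesic from `a` to `b`. -/
def HasEdge (X : SimpleGraph V) (a b : BowditchCompactification X) (x y : V) : Prop :=
  ∃ S γ n, Joins X S γ a b ∧ n ∈ S ∧ n + 1 ∈ S ∧ γ n = x ∧ γ (n + 1) = y

theorem Joins.hasEdge {S : Set ℤ} {γ : ℤ → V} {a b : BowditchCompactification X}
    (h : Joins X S γ a b) {n : ℤ} (hn : n ∈ S) (hn' : n + 1 ∈ S) :
    HasEdge X a b (γ n) (γ (n + 1)) :=
  ⟨S, γ, n, h, hn, hn', rfl, rfl⟩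

theorem HasEdge.swap {a b : BowditchCompactification X} {x y : V} (h : HasEdge X a b x y) :
    HasEdge X b a y x := by
  obtain ⟨S, γ, n, h, hn, hn', rfl, rfl⟩ := h
  exact ⟨_, _, -(n + 1), h.reflect, by simpa using hn', by simpa using hn, by simp, by simp⟩

theorem PosEnd.endpoint_eq (hc : X.Connected) {S : Set ℤ} {γ : ℤ → V} {ξ : GromovBoundary X}
    (hγ : IsGeo X S γ) (h : PosEnd X S γ (boundary ξ)) {p : GeodesicRay X} {t : ℤ}
    (hp : ∀ n : ℕ, t + n ∈ S ∧ γ (t + n) = p.toFun n) : p.endpoint = ξ := by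
  obtain ⟨q, rfl, s, hs⟩ := h
  rw [GeodesicRay.endpoint_eq_iff hc]
  refine ⟨(t - s).natAbs, fun n => ?_⟩
  rw [← (hp n).2, ← (hs n).2]
  have : X.dist (γ (t + n)) (γ (s + n)) ≤ (t - s).natAbs := by
    rcases le_total t s with h | h
    · have := hγ.dist_eq _ (hp n).1 _ (hs n).1 (by omega)
      omega
    · have := hγ.dist_eq _ (hs n).1 _ (hp n).1 (by omega)
      rw [X.dist_comm] at this
      omega
  exact_mod_cast this

theorem GeodesicRay.joins (p : GeodesicRay X) :
    Joins X (Ici 0) (fun i => p.toFun i.toNat) (vertex (p.toFun 0)) (boundary p.endpoint) := by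
  refine ⟨p.isGeo, ⟨0, ⟨by simp, fun i hi => ?_⟩, by simp⟩, p, rfl, 0, fun n => by simp⟩
  have : 0 ≤ -i := hi
  omega

theorem GeodesicLine.joins (p : GeodesicLine X) :
    Joins X univ p.toFun (boundary p.backward.endpoint) (boundary p.forward.endpoint) := by
  refine ⟨⟨ordConnected_univ, fun i _ j _ hij => ?_⟩,
    ⟨p.backward, rfl, 0, fun n => by simp [GeodesicLine.backward]⟩,
    ⟨p.forward, rfl, 0, fun n => by simp [GeodesicLine.forward]⟩⟩
  have := p.dist_eq i (j - i).toNat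
  have e : i + ((j - i).toNat : ℤ) = j := by omega
  rw [e] at this
  omega

theorem exists_ray_of_hasEdge (hc : X.Connected) {x y z : V} {ξ : GromovBoundary X}
    (h : HasEdge X (vertex z) (boundary ξ) x y) :
    ∃ p : GeodesicRay X, p.toFun 0 = z ∧ p.endpoint = ξ ∧ s(x, y) ∈ p.edges := by
  obtain ⟨S, γ, n, h, hn, hn', rfl, rfl⟩ := h
  obtain ⟨m, hm, rfl⟩ := h.negEnd
  have hmS : -m ∈ S := hm.1
  have hmn : -m ≤ n := by
    have := hm.2 (show -n ∈ Neg.neg ⁻¹' S by simpa using hn)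
    omega
  have hmem : ∀ k : ℕ, -m + k ∈ S := by
    intro k
    obtain ⟨p, -, s, hs⟩ := h.posEnd
    exact h.mem hmS (hs (k + s.natAbs + m.natAbs)).1 (by omega) (by omega)
  refine ⟨h.toIsGeo.ray (-m) hmem, by simp [IsGeo.ray],
    h.posEnd.endpoint_eq hc h.toIsGeo (t := -m) fun k => ⟨hmem k, rfl⟩, (n + m).toNat, ?_⟩
  have e : -m + ((n + m).toNat : ℤ) = n := by omega
  simp only [IsGeo.ray]
  push_cast
  rw [← add_assoc, e]

/-- The bridge from walks, rays and lines to `Joins`, which removes the case distinction on the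
types of the endpoints from then on. -/
theorem exists_geodesicEdgeSets_iff (hc : X.Connected) {a b : BowditchCompactification X}
    {x y : V} : (∃ E ∈ geodesicEdgeSets X a b, s(x, y) ∈ E) ↔
      HasEdge X a b x y ∨ HasEdge X a b y x := by
  have hray : ∀ {z : V} {ξ : GromovBoundary X},
      (∃ p : GeodesicRay X, p.toFun 0 = z ∧ p.endpoint = ξ ∧ s(x, y) ∈ p.edges) →
      HasEdge X (vertex z) (boundary ξ) x y ∨ HasEdge X (vertex z) (boundary ξ) y x := by
    rintro z ξ ⟨p, rfl, rfl, n, hn⟩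
    have h := p.joins.hasEdge (n := n) (by simp) (by simp; omega)
    have e : ((n : ℤ) + 1).toNat = n + 1 := by omega
    simp only [e, Int.toNat_natCast] at h
    simp only [Sym2.eq_iff] at hn
    rcases hn with ⟨h₁, h₂⟩ | ⟨h₁, h₂⟩
    · left; rwa [h₁, h₂] at h
    · right; rwa [h₁, h₂] at h
  have hray' : ∀ {z : V} {ξ : GromovBoundary X},
      HasEdge X (vertex z) (boundary ξ) x y ∨ HasEdge X (vertex z) (boundary ξ) y x →
      ∃ p : GeodesicRay X, p.toFun 0 = z ∧ p.endpoint = ξ ∧ s(x, y) ∈ p.edges := by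
    rintro z ξ (h | h)
    · exact exists_ray_of_hasEdge hc h
    · rw [Sym2.eq_swap]
      exact exists_ray_of_hasEdge hc h
  cases a with
  | vertex v =>
    cases b with
    | vertex w =>
      constructor
      · rintro ⟨_, ⟨p, hp, rfl⟩, he⟩
        have hj := joins_of_walk hc p hp
        obtain ⟨n, hn, hn'⟩ := List.getElem_of_mem (show s(x, y) ∈ p.edges from he)
        rw [SimpleGraph.Walk.getElem_edges] at hn'
        rw [SimpleGraph.Walk.length_edges] at hn
        have h := hj.hasEdge (n := n) ⟨by omega, by omega⟩ ⟨by omega, by omega⟩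
        have e : ((n : ℤ) + 1).toNat = n + 1 := by omega
        simp only [e, Int.toNat_natCast] at h
        simp only [Sym2.eq_iff] at hn'
        rcases hn' with ⟨h₁, h₂⟩ | ⟨h₁, h₂⟩
        · left; rwa [h₁, h₂] at h
        · right; rwa [h₁, h₂] at h
      · have key : ∀ {x y}, HasEdge X (vertex v) (vertex w) x y →
            ∃ p : X.Walk v w, p.length = X.dist v w ∧ s(x, y) ∈ p.edges := by
          rintro x y ⟨S, γ, n, h, hn, hn', rfl, rfl⟩
          obtain ⟨m, hm, rfl⟩ := h.negEnd
          obtain ⟨m', hm', rfl⟩ := h.posEnd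
          have hmS : -m ∈ S := hm.1
          have hmn : -m ≤ n := by
            have := hm.2 (show -n ∈ Neg.neg ⁻¹' S by simpa using hn)
            omega
          have hnm := hm'.2 hn'
          obtain ⟨p, hp⟩ := hc.exists_walk_length_eq_dist (γ (-m)) (γ n)
          obtain ⟨q, hq⟩ := hc.exists_walk_length_eq_dist (γ (n + 1)) (γ m')
          have d₁ := h.dist_eq _ hmS _ hn hmn
          have d₂ := h.dist_eq _ hn' _ hm'.1 hnm
          have d₃ := h.dist_eq _ hmS _ hm'.1 (by omega)
          refine ⟨p.append (.cons (h.adj hn hn') q), ?_, by simp⟩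
          rw [SimpleGraph.Walk.length_append, SimpleGraph.Walk.length_cons]
          change _ = X.dist (γ (-m)) (γ m')
          omega
        rintro (h | h)
        · obtain ⟨p, hp, hp'⟩ := key h
          exact ⟨_, ⟨p, hp, rfl⟩, hp'⟩
        · obtain ⟨p, hp, hp'⟩ := key h
          refine ⟨_, ⟨p, hp, rfl⟩, ?_⟩
          rwa [Sym2.eq_swap] at hp'
    | boundary ξ =>
      constructor
      · rintro ⟨_, ⟨p, h₁, h₂, rfl⟩, he⟩
        exact hray ⟨p, h₁, h₂, he⟩
      · intro h
        obtain ⟨p, h₁, h₂, he⟩ := hray' h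
        exact ⟨_, ⟨p, h₁, h₂, rfl⟩, he⟩
  | boundary ξ =>
    cases b with
    | vertex w =>
      constructor
      · rintro ⟨_, ⟨p, h₁, h₂, rfl⟩, he⟩
        exact (hray ⟨p, h₁, h₂, he⟩).symm.imp HasEdge.swap HasEdge.swap
      · intro h
        obtain ⟨p, h₁, h₂, he⟩ := hray' (h.symm.imp HasEdge.swap HasEdge.swap)
        exact ⟨_, ⟨p, h₁, h₂, rfl⟩, he⟩
    | boundary η =>
      constructor
      · rintro ⟨_, ⟨p, rfl, rfl, rfl⟩, n, hn⟩
        have h := p.joins.hasEdge (n := n) (mem_univ _) (mem_univ _)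
        simp only [Sym2.eq_iff] at hn
        rcases hn with ⟨h₁, h₂⟩ | ⟨h₁, h₂⟩
        · left; rwa [h₁, h₂] at h
        · right; rwa [h₁, h₂] at h
      · have key : ∀ {x y}, HasEdge X (boundary ξ) (boundary η) x y →
            ∃ p : GeodesicLine X, p.backward.endpoint = ξ ∧ p.forward.endpoint = η ∧
              s(x, y) ∈ p.edges := by
          rintro x y ⟨S, γ, n, h, -, -, rfl, rfl⟩
          have hS : ∀ k, k ∈ S := by
            intro k
            obtain ⟨p, -, s, hs⟩ := h.posEnd
            obtain ⟨q, -, t, ht⟩ := h.negEnd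
            have h₁ := (hs (k.natAbs + s.natAbs)).1
            have h₂ : -(t + ((k.natAbs + t.natAbs : ℕ) : ℤ)) ∈ S := (ht (k.natAbs + t.natAbs)).1
            exact h.mem h₂ h₁ (by omega) (by omega)
          let p : GeodesicLine X :=
            { toFun := γ
              adj := fun i => h.adj (hS _) (hS _)
              dist_eq := fun i k => by
                have := h.dist_eq i (hS _) (i + k) (hS _) (by omega)
                omega }
          exact ⟨p, PosEnd.endpoint_eq hc h.toIsGeo.reflect h.negEnd (t := 0)
              fun k => ⟨hS _, by simp [p, GeodesicLine.backward]⟩,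
            h.posEnd.endpoint_eq hc h.toIsGeo (t := 0)
              fun k => ⟨hS _, by simp [p, GeodesicLine.forward]⟩, n, rfl⟩
        rintro (h | h)
        · obtain ⟨p, h₁, h₂, he⟩ := key h
          exact ⟨_, ⟨p, h₁, h₂, rfl⟩, he⟩
        · obtain ⟨p, h₁, h₂, he⟩ := key h
          rw [Sym2.eq_swap] at he
          exact ⟨_, ⟨p, h₁, h₂, rfl⟩, he⟩

theorem mem_avoidingSet_iff (hc : X.Connected) {a b : BowditchCompactification X}
    {I : Set (Sym2 V)} : b ∈ avoidingSet X a I ↔ ∀ x y, HasEdge X a b x y → s(x, y) ∉ I := by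
  constructor
  · intro h x y hxy he
    obtain ⟨E, hE, heE⟩ := (exists_geodesicEdgeSets_iff hc).2 (Or.inl hxy)
    exact disjoint_left.1 (h E hE) he heE
  · intro h E hE
    rw [disjoint_left]
    intro e he heE
    induction e using Sym2.ind with
    | _ x y =>
      rcases (exists_geodesicEdgeSets_iff hc).1 ⟨E, hE, heE⟩ with h' | h'
      · exact h x y h' he
      · exact h y x h' (by rwa [Sym2.eq_swap])

/-- At a boundary point, the two halves of such a geodesic would be rays at bounded distance, yet
their points move apart along the geodesic. -/
theorem not_hasEdge_self (hc : X.Connected) {a : BowditchCompactification X} {x y : V} :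
    ¬HasEdge X a a x y := by
  rintro ⟨S, γ, n, h, hn, hn', -, -⟩
  cases a with
  | vertex v =>
    obtain ⟨m, hm, hmv⟩ := h.negEnd
    obtain ⟨m', hm', hmv'⟩ := h.posEnd
    have h₁ : -m ≤ n := by
      have := hm.2 (show -n ∈ Neg.neg ⁻¹' S by simpa using hn)
      omega
    have h₂ := hm'.2 hn'
    have h₃ := h.dist_eq (-m) hm.1 m' hm'.1 (by omega)
    dsimp only at hmv
    rw [hmv, hmv', SimpleGraph.dist_self] at h₃
    push_cast at h₃
    omega
  | boundary ξ =>
    obtain ⟨p, rfl, s, hs⟩ := h.negEnd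
    obtain ⟨q, hpq, t, ht⟩ := h.posEnd
    obtain ⟨C, hC⟩ := (GeodesicRay.endpoint_eq_iff hc).1 hpq
    obtain ⟨k, hk⟩ := exists_nat_gt C
    set j := k + s.natAbs + t.natAbs with hj
    have h₁ : -(s + j) ∈ S := (hs j).1
    have h₂ := h.dist_eq _ h₁ _ (ht j).1 (by omega)
    have h₃ : γ (-(s + j)) = p.toFun j := (hs j).2
    rw [(ht j).2, h₃, X.dist_comm] at h₂
    have h₄ : k ≤ X.dist (q.toFun j) (p.toFun j) := by omega
    have h₅ : (k : ℝ) ≤ X.dist (q.toFun j) (p.toFun j) := by exact_mod_cast h₄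
    linarith [hC j]

theorem Joins.exists_hasEdge {S : Set ℤ} {γ : ℤ → V} {a b : BowditchCompactification X}
    (h : Joins X S γ a b) (hab : a ≠ b) : ∃ n, n ∈ S ∧ n + 1 ∈ S := by
  obtain ⟨t, ht⟩ := h.posEnd.nonempty
  by_cases hb : b = vertex (γ t)
  · have h₁ := h.reflect.toIsGeo.succ_mem h.reflect.posEnd (i := -t) (by simpa using ht)
      (by simpa [← hb] using hab)
    refine ⟨t - 1, ?_, by simpa using ht⟩
    have e : -(-t + 1) = t - 1 := by ring
    rwa [mem_preimage, e] at h₁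
  · exact ⟨t, ht, h.toIsGeo.succ_mem h.posEnd ht hb⟩

/-! ### The Bowditch topology -/

/-- Shifted so that the edge sits at parameters `0` and `1`, the geodesics have a limit, which
retains the edge; uniqueness identifies its ends. -/
theorem StronglyConverges.hasEdge (hX : IsFine X) (hh : IsHyperbolic X)
    {ι : Type*} {l : Ultrafilter ι} {a b : ι → BowditchCompactification X} {a' b' : _}
    (ha : StronglyConverges l a a') (hb : StronglyConverges l b b') {x y : V}
    (hxy : ∀ᶠ i in l, HasEdge X (a i) (b i) x y) : HasEdge X a' b' x y := by
  obtain ⟨S, hS⟩ := hxy.choice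
  obtain ⟨γ, hγ⟩ := hS.choice
  obtain ⟨t, ht⟩ := hγ.choice
  have h0 : ∀ᶠ i in l, 0 ∈ (· + t i) ⁻¹' S i ∧ γ i (0 + t i) = x := by
    filter_upwards [ht] with i hi
    simpa using ⟨hi.2.1, hi.2.2.2.1⟩
  have h1 : ∀ᶠ i in l, 0 + 1 ∈ (· + t i) ⁻¹' S i ∧ γ i (0 + 1 + t i) = y := by
    filter_upwards [ht] with i hi
    simpa [add_comm] using ⟨hi.2.2.1, hi.2.2.2.2⟩
  obtain ⟨a'', b'', T, σ, hσ, ha', hb', hT⟩ := exists_joins_limit hX hh l (u := x)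
    (ht.mono fun i h => h.1.shift (t i)) h0
  rw [← ha.unique hX hh ha', ← hb.unique hX hh hb'] at hσ
  have h0' := (hT 0 x).2 h0
  have h1' := (hT (0 + 1) y).2 h1
  exact ⟨T, σ, 0, hσ, h0'.1, h1'.1, h0'.2, h1'.2⟩

/-- A closedness statement in both variables: as `I` is finite, one of its edges is met along the
ultrafilter and survives in the limit. -/
theorem StronglyConverges.notMem_avoidingSet (hX : IsFine X) (hh : IsHyperbolic X)
    {ι : Type*} {l : Ultrafilter ι} {a b : ι → BowditchCompactification X} {a' b' : _}
    (ha : StronglyConverges l a a') (hb : StronglyConverges l b b') {I : Set (Sym2 V)}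
    (hI : I.Finite) (h : ∀ᶠ i in l, b i ∉ avoidingSet X (a i) I) : b' ∉ avoidingSet X a' I := by
  have hc := hh.connected
  simp only [mem_avoidingSet_iff hc] at h ⊢
  push Not at h ⊢
  obtain ⟨e, he, he'⟩ := (Ultrafilter.eventually_exists_mem_iff
    (P := fun e i => ∃ x y, HasEdge X (a i) (b i) x y ∧ s(x, y) = e) hI).1 (by
      filter_upwards [h] with i hi
      obtain ⟨x, y, hxy, hI⟩ := hi
      exact ⟨_, hI, x, y, hxy, rfl⟩)
  induction e using Sym2.ind with
  | _ x y =>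
    have h₂ : ∀ᶠ i in l, HasEdge X (a i) (b i) x y ∨ HasEdge X (a i) (b i) y x := by
      filter_upwards [he'] with i hi
      obtain ⟨x', y', h, e⟩ := hi
      rw [Sym2.eq_iff] at e
      rcases e with ⟨rfl, rfl⟩ | ⟨rfl, rfl⟩
      · exact Or.inl h
      · exact Or.inr h
    rcases Ultrafilter.eventually_or.1 h₂ with h₃ | h₃
    · exact ⟨x, y, ha.hasEdge hX hh hb h₃, he⟩
    · exact ⟨y, x, ha.hasEdge hX hh hb h₃, by rwa [Sym2.eq_swap]⟩

theorem self_mem_avoidingSet (hc : X.Connected) (a : BowditchCompactification X)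
    (I : Set (Sym2 V)) : a ∈ avoidingSet X a I :=
  (mem_avoidingSet_iff hc).2 fun _ _ h => absurd h (not_hasEdge_self hc)

/-- For the converse, let `c i` tend to `a' ≠ a`. Geodesics from `a` to `c i` converge to one from
`a` to `a'`, and eventually contain a given edge `e` of it, so `c i` leaves the avoiding set of
`{e}`. -/
theorem stronglyConverges_iff (hX : IsFine X) (hh : IsHyperbolic X) {ι : Type*}
    {l : Ultrafilter ι} {c : ι → BowditchCompactification X} {a : BowditchCompactification X} :
    StronglyConverges l c a ↔
      ∀ I : Set (Sym2 V), I.Finite ∧ I ⊆ X.edgeSet → ∀ᶠ i in l, c i ∈ avoidingSet X a I := by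
  have hc := hh.connected
  constructor
  · rintro h I ⟨hI, -⟩
    by_contra hcon
    rw [← Ultrafilter.eventually_not] at hcon
    exact (stronglyConverges_const hc (l : Filter ι) a).notMem_avoidingSet hX hh h hI hcon
      (self_mem_avoidingSet hc a I)
  · intro h
    obtain ⟨a', ha'⟩ := exists_stronglyConverges hX hh l c
    by_cases hne : a = a'
    · rwa [hne]
    exfalso
    have hca : ∀ᶠ i in l, a ≠ c i := by
      rw [Ultrafilter.eventually_not]
      intro hca
      exact hne (((stronglyConverges_const hc (l : Filter ι) a).congr hca).unique hX hh ha')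
    obtain ⟨S, hS⟩ := (hca.mono fun i hi => exists_joins hX hh hi).choice
    obtain ⟨γ, hγ⟩ := hS.choice
    obtain ⟨T, σ, hσ, t, ht⟩ :=
      (stronglyConverges_const hc (l : Filter ι) a).exists_joins hX hh ha' hne hγ
    obtain ⟨n, hn, hn'⟩ := hσ.exists_hasEdge hne
    have h₁ := h {s(σ n, σ (n + 1))} ⟨finite_singleton _, by
      simpa using hσ.adj hn hn'⟩
    obtain ⟨i, hi, hi', hγi, hmem⟩ := ((ht n hn).and ((ht _ hn').and (hγ.and h₁))).exists
    have e : n + 1 + t i = n + t i + 1 := by ring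
    rw [e] at hi'
    refine (mem_avoidingSet_iff hc).1 hmem _ _ (hγi.hasEdge hi.1 hi'.1) ?_
    rw [hi.2, hi'.2]
    rfl

/-- Otherwise the finite edge sets index points outside the set that converge strongly to `b`, and
`StronglyConverges.notMem_avoidingSet` puts `b` outside as well. -/
theorem isOpen_avoidingSet (hX : IsFine X) (hh : IsHyperbolic X) (a : BowditchCompactification X)
    {I : Set (Sym2 V)} (hI : I.Finite) : IsOpen (avoidingSet X a I) := by
  classical
  intro b hb
  by_contra hcon
  push Not at hcon
  have key : ∀ K : Finset (Sym2 V), ∃ c, c ∈ avoidingSet X b (K ∩ X.edgeSet) ∧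
      c ∉ avoidingSet X a I := fun K =>
    not_subset.1 (hcon _ (K.finite_toSet.inter_of_left _) inter_subset_right)
  choose c hc hc' using key
  let l : Ultrafilter (Finset (Sym2 V)) := Ultrafilter.of atTop
  have hl : StronglyConverges l c b := by
    rw [stronglyConverges_iff hX hh]
    rintro J ⟨hJ, hJX⟩
    filter_upwards [Ultrafilter.of_le atTop (eventually_ge_atTop hJ.toFinset)] with K hK
    refine avoidingSet_anti X b (subset_inter (fun e he => ?_) hJX) (hc K)
    exact hK (hJ.mem_toFinset.2 he)
  exact (stronglyConverges_const hh.connected (l : Filter (Finset (Sym2 V))) a).notMem_avoidingSet hX hh hl hI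
    (Eventually.of_forall hc') hb

theorem hasBasis_nhds (hX : IsFine X) (hh : IsHyperbolic X) (a : BowditchCompactification X) :
    (𝓝 a).HasBasis (fun I : Set (Sym2 V) => I.Finite ∧ I ⊆ X.edgeSet) (avoidingSet X a) := by
  refine ⟨fun s => ⟨fun hs => ?_, ?_⟩⟩
  · obtain ⟨U, hUs, hU, haU⟩ := mem_nhds_iff.1 hs
    obtain ⟨I, hI, hIX, hIU⟩ := hU a haU
    exact ⟨I, ⟨hI, hIX⟩, hIU.trans hUs⟩
  · rintro ⟨I, ⟨hI, -⟩, hIs⟩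
    exact mem_of_superset ((isOpen_avoidingSet hX hh a hI).mem_nhds
      (self_mem_avoidingSet hh.connected a I)) hIs

theorem tendsto_nhds_iff_stronglyConverges (hX : IsFine X) (hh : IsHyperbolic X) {ι : Type*}
    {l : Ultrafilter ι} {c : ι → BowditchCompactification X} {a : BowditchCompactification X} :
    Tendsto c l (𝓝 a) ↔ StronglyConverges l c a := by
  rw [(hasBasis_nhds hX hh a).tendsto_right_iff, stronglyConverges_iff hX hh]

theorem compactSpace (hX : IsFine X) (hh : IsHyperbolic X) :
    CompactSpace (BowditchCompactification X) := by
  refine ⟨isCompact_iff_ultrafilter_le_nhds.2 fun l _ => ?_⟩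
  obtain ⟨a, ha⟩ := exists_stronglyConverges hX hh l id
  exact ⟨a, mem_univ a, (tendsto_nhds_iff_stronglyConverges hX hh).2 ha⟩

theorem t2Space (hX : IsFine X) (hh : IsHyperbolic X) :
    T2Space (BowditchCompactification X) :=
  t2_iff_ultrafilter.2 fun {_ _} l ha hb =>
    ((tendsto_nhds_iff_stronglyConverges hX hh (l := l) (c := id)).1 ha).unique hX hh
      ((tendsto_nhds_iff_stronglyConverges hX hh).1 hb)

/-! ### The action on geodesics -/

section Action

variable {G : Type v} [Group G] [MulAction G V] [GraphAction G X]

theorem PosEnd.smul (g : G) {S : Set ℤ} {γ : ℤ → V} {b : BowditchCompactification X}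
    (h : PosEnd X S γ b) : PosEnd X S (fun i => g • γ i) (g • b) := by
  cases b with
  | vertex y =>
    obtain ⟨m, hm, rfl⟩ := h
    exact ⟨m, hm, rfl⟩
  | boundary ξ =>
    obtain ⟨p, rfl, s, hs⟩ := h
    exact ⟨g • p, rfl, s, fun n => ⟨(hs n).1, congrArg (g • ·) (hs n).2⟩⟩

theorem Joins.smul (g : G) {S : Set ℤ} {γ : ℤ → V} {a b : BowditchCompactification X}
    (h : Joins X S γ a b) : Joins X S (fun i => g • γ i) (g • a) (g • b) :=
  ⟨⟨h.ordConnected, fun i hi j hj hij => by rw [dist_smul, h.dist_eq i hi j hj hij]⟩,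
    PosEnd.smul g h.negEnd, h.posEnd.smul g⟩

theorem HasEdge.smul (g : G) {a b : BowditchCompactification X} {x y : V}
    (h : HasEdge X a b x y) : HasEdge X (g • a) (g • b) (g • x) (g • y) := by
  obtain ⟨S, γ, n, h, hn, hn', rfl, rfl⟩ := h
  exact (h.smul g).hasEdge hn hn'

theorem IsFirstStep.smul (g : G) {k y : V} {b : BowditchCompactification X}
    (h : IsFirstStep X k b y) : IsFirstStep X (g • k) (g • b) (g • y) := by
  obtain ⟨S, γ, h, hb, h0, h1, rfl, rfl⟩ := h
  exact ⟨S, fun i => g • γ i, ⟨h.ordConnected, fun i hi j hj hij => by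
    rw [dist_smul, h.dist_eq i hi j hj hij]⟩, hb.smul g, h0, h1, rfl, rfl⟩

theorem StepToward.smul (g : G) {k z y : V} (h : StepToward X k z y) :
    StepToward X (g • k) (g • z) (g • y) :=
  ⟨(GraphAction.adj_smul_iff g k y).2 h.1, by rw [dist_smul, dist_smul, h.2]⟩

theorem continuousConstSMul (hX : IsFine X) (hh : IsHyperbolic X) :
    ContinuousConstSMul G (BowditchCompactification X) := by
  have hc := hh.connected
  refine ⟨fun g => continuous_iff_continuousAt.2 fun a => ?_⟩
  refine (hasBasis_nhds hX hh (g • a)).tendsto_right_iff.2 fun I hI => ?_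
  filter_upwards [(isOpen_avoidingSet hX hh a (hI.1.image (Sym2.map (g⁻¹ • ·)))).mem_nhds
    (self_mem_avoidingSet hc a _)] with c hca
  rw [mem_avoidingSet_iff hc] at hca ⊢
  intro x y hxy he
  have h := hxy.smul g⁻¹
  rw [inv_smul_smul, inv_smul_smul] at h
  exact hca _ _ h ⟨_, he, rfl⟩

/-! ### The convergence property -/

/-- If the images of `v` and `v'` are constant, a first step `y` from `v` towards `v'` is sent into
a finite set, so its image is constant too. Then `(g i₀)⁻¹ * g i` lies in the finite stabilizer of
an edge, and `g i` is eventually constant. -/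
theorem not_eventually_smul_eq (hX : IsFine X) (hc : X.Connected)
    (hstab : ∀ x y : V, X.Adj x y →
      Finite ↥(MulAction.stabilizer G x ⊓ MulAction.stabilizer G y))
    {ι : Type*} {l : Ultrafilter ι} {g : ι → G} (hg : ∀ x, ∀ᶠ i in l, g i ≠ x)
    {v v' w w' : V} (hv : v ≠ v') (h : ∀ᶠ i in l, g i • v = w) : ¬∀ᶠ i in l, g i • v' = w' := by
  intro h'
  obtain ⟨y, hy⟩ := exists_stepToward hc hv
  obtain ⟨y', -, hy'⟩ := (Ultrafilter.eventually_exists_mem_iff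
    (P := fun y' i => g i • y = y') (finite_stepToward hX hc w w')).1 (by
      filter_upwards [h, h'] with i hi hi'
      refine ⟨_, ?_, rfl⟩
      rw [← hi, ← hi']
      exact hy.smul (g i))
  obtain ⟨i₀, hi₀, hi₀'⟩ := (h.and hy').exists
  have hfin : ((MulAction.stabilizer G v ⊓ MulAction.stabilizer G y : Subgroup G) : Set G).Finite :=
    hstab v y hy.1
  obtain ⟨s, -, hs⟩ := (Ultrafilter.eventually_exists_mem_iff
    (P := fun s i => (g i₀)⁻¹ * g i = s) hfin).1 (by
      filter_upwards [h, hy'] with i hi hi'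
      refine ⟨_, Subgroup.mem_inf.2 ⟨?_, ?_⟩, rfl⟩ <;>
        rw [MulAction.mem_stabilizer_iff, mul_smul, inv_smul_eq_iff]
      · rw [hi, hi₀]
      · rw [hi', hi₀'])
  obtain ⟨i, hi, hi'⟩ := (hs.and (hg (g i₀ * s))).exists
  exact hi' (inv_mul_eq_iff_eq_mul.1 hi)

theorem Joins.dist_add_dist {S : Set ℤ} {γ : ℤ → V} {x : V} {b : BowditchCompactification X}
    (h : Joins X S γ (vertex x) b) {n m : ℤ} (hn : n ∈ S) (hm : m ∈ S) (hnm : n ≤ m) :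
    X.dist x (γ n) + X.dist (γ n) (γ m) = X.dist x (γ m) := by
  obtain ⟨t, ht, hx⟩ := h.negEnd
  have htS : -t ∈ S := ht.1
  have htn : -t ≤ n := by
    have := ht.2 (show -n ∈ Neg.neg ⁻¹' S by simpa using hn)
    omega
  dsimp only at hx
  have h₁ := h.dist_eq _ htS _ hn htn
  have h₂ := h.dist_eq _ hn _ hm hnm
  have h₃ := h.dist_eq _ htS _ hm (htn.trans hnm)
  rw [hx] at h₁ h₃
  omega

/-- If no vertex has an eventually constant image, then all orbit maps have the same limit. -/
theorem stronglyConverges_smul_vertex (hX : IsFine X) (hh : IsHyperbolic X)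
    {ι : Type*} {l : Ultrafilter ι} {g : ι → G} (hg : ∀ v w : V, ¬∀ᶠ i in l, g i • v = w)
    {b : BowditchCompactification X} {x y : V}
    (h : StronglyConverges l (fun i => vertex (g i • x)) b) :
    StronglyConverges l (fun i => vertex (g i • y)) b := by
  have hc := hh.connected
  obtain ⟨p⟩ := hc.preconnected x y
  induction p with
  | nil => exact h
  | @cons x z y hadj p ih =>
    refine ih ?_
    obtain ⟨b', hb'⟩ := exists_stronglyConverges hX hh l fun i => vertex (g i • z)
    by_cases hne : b = b'
    · rwa [hne]
    exfalso
    choose S γ hγ hS h0 using fun i => exists_joins_vertex_vertex hc (g i • x) (g i • z)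
    -- Geodesics between adjacent vertices have no interior vertices, so a common vertex is a
    -- persistent value of `g i • x` or of `g i • z`.
    obtain ⟨w, hw⟩ := h.exists_common_vertex hX hh hb' hne (Eventually.of_forall hγ)
    have h₁ : ∀ᶠ i in l, g i • x = w ∨ g i • z = w := by
      filter_upwards [hw] with i hi
      obtain ⟨n, hn, rfl⟩ := hi
      obtain ⟨m, hm, hmz⟩ := (hγ i).posEnd
      have h₂ := (hγ i).dist_add_dist hn hm.1 (hm.2 hn)
      rw [hmz, SimpleGraph.dist_eq_one_iff_adj.2
        ((GraphAction.adj_smul_iff (g i) x z).2 hadj)] at h₂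
      rcases Nat.eq_zero_or_pos (X.dist (g i • x) (γ i n)) with h₃ | h₃
      · exact Or.inl (hc.dist_eq_zero_iff.1 h₃)
      · exact Or.inr (hc.dist_eq_zero_iff.1 (by omega : X.dist (γ i n) (g i • z) = 0)).symm
    rcases Ultrafilter.eventually_or.1 h₁ with h₂ | h₂
    · exact hg _ _ h₂
    · exact hg _ _ h₂

/-- The points `k i` vary with `i` because locally uniform convergence reduces to this form by
compactness. -/
theorem exists_attracting_repelling (hX : IsFine X) (hh : IsHyperbolic X)
    (hstab : ∀ x y : V, X.Adj x y →
      Finite ↥(MulAction.stabilizer G x ⊓ MulAction.stabilizer G y))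
    {ι : Type*} (l : Ultrafilter ι) {g : ι → G} (hg : ∀ x, ∀ᶠ i in l, g i ≠ x) :
    ∃ a b : BowditchCompactification X, ∀ (k : ι → BowditchCompactification X) k',
      StronglyConverges l k k' → k' ≠ a → StronglyConverges l (fun i => g i • k i) b := by
  obtain ⟨hc, δ, hδ⟩ := id hh
  by_cases hfix : ∃ v w : V, ∀ᶠ i in l, g i • v = w
  · obtain ⟨v, w, hvw⟩ := hfix
    -- Some first step `y₁` from `v` towards `k i` persists. If `y` persists as a first step from
    -- `w` towards `g i • k i`, then `g i • y₁` stays in a finite link ball around `y`, so `v` and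
    -- `y₁` both have constant images.
    refine ⟨vertex v, vertex w, fun k k' hk hk' y => ?_⟩
    rw [Ultrafilter.eventually_not]
    intro hy
    have hkv : ¬StronglyConverges l k (vertex v) := fun h => hk' (hk.unique hX hh h)
    simp only [StronglyConverges, not_forall, Ultrafilter.eventually_not, not_not] at hkv
    obtain ⟨y₁, hy₁⟩ := hkv
    obtain ⟨i₀, hi₀⟩ := hy.exists
    obtain ⟨i₁, hi₁⟩ := hy₁.exists
    obtain ⟨w', -, hw'⟩ := (Ultrafilter.eventually_exists_mem_iff
      (P := fun w' i => g i • y₁ = w') (hX.finite_linkClose hi₀.adj (24 * δ + 4))).1 (by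
        filter_upwards [hvw, hy, hy₁] with i h₁ h₂ h₃
        have h₄ := h₃.smul (g i)
        rw [h₁] at h₄
        exact ⟨_, ⟨h₄.adj, h₂.linkClose hδ hc h₄⟩, rfl⟩)
    exact not_eventually_smul_eq hX hc hstab hg hi₁.adj.ne hvw hw'
  have hfix' : ∀ v w : V, ¬∀ᶠ i in l, g i • v = w := fun v w h => hfix ⟨v, w, h⟩
  obtain ⟨x⟩ := hc.nonempty
  obtain ⟨a, ha⟩ := exists_stronglyConverges hX hh l fun i => vertex ((g i)⁻¹ • x)
  obtain ⟨b, hb⟩ := exists_stronglyConverges hX hh l fun i => vertex (g i • x)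
  refine ⟨a, b, fun k k' hk hk' => ?_⟩
  obtain ⟨b', hb'⟩ := exists_stronglyConverges hX hh l fun i => g i • k i
  by_cases hne : b = b'
  · rwa [hne]
  exfalso
  -- These geodesics share a vertex `u`, and their translates start at `x` and pass through `g i •
  -- u`, which tends to `b`. As `g i • k i` tends to `b' ≠ b`, the parts after `g i • u` share a
  -- vertex `w`. Thus `g i • u` lies between `x` and `w`, in a finite set.
  choose S γ hγ hS h0 using fun i => exists_joins_vertex hX hh ((g i)⁻¹ • x) (k i)
  obtain ⟨u, hu⟩ := ha.exists_common_vertex hX hh hk hk'.symm (Eventually.of_forall hγ)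
  obtain ⟨t, ht⟩ := hu.choice
  have hγ' : ∀ i, Joins X (S i) (fun n => g i • γ i n) (vertex x) (g i • k i) := by
    intro i
    have := (hγ i).smul (g i)
    have e : g i • (vertex ((g i)⁻¹ • x) : BowditchCompactification X) = vertex x :=
      congrArg vertex (smul_inv_smul (g i) x)
    rwa [e] at this
  have hgu := stronglyConverges_smul_vertex hX hh hfix' (y := u) hb
  obtain ⟨w, hw⟩ := hgu.exists_common_vertex hX hh hb' hne
    (S := fun i => S i ∩ Ici (t i)) (γ := fun i n => g i • γ i n) (by
      filter_upwards [ht] with i hi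
      have := (hγ' i).restrict_Ici hc hi.1
      rwa [hi.2] at this)
  obtain ⟨w', -, hw'⟩ := (Ultrafilter.eventually_exists_mem_iff
    (P := fun w' i => g i • u = w') (finite_between hX hc x w)).1 (by
      filter_upwards [ht, hw] with i hi hwi
      obtain ⟨n, hn, rfl⟩ := hwi
      refine ⟨_, ?_, rfl⟩
      rw [← hi.2]
      exact (hγ' i).dist_add_dist hi.1 hn.1 hn.2)
  exact hfix' _ _ hw'

/-- A failure on `K` selects `k i` in `K` with `g i • k i` outside `U`. By compactness `k i` has a
limit in `K`, which is not `a`, so `g i • k i` tends to `b`. -/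
theorem eventually_smul_mem (hX : IsFine X) (hh : IsHyperbolic X)
    (hstab : ∀ x y : V, X.Adj x y →
      Finite ↥(MulAction.stabilizer G x ⊓ MulAction.stabilizer G y))
    {ι : Type*} (l : Ultrafilter ι) {g : ι → G} (hg : ∀ x, ∀ᶠ i in l, g i ≠ x) :
    ∃ a b : BowditchCompactification X, ∀ K : Set (BowditchCompactification X), IsCompact K →
      K ⊆ {a}ᶜ → ∀ U, IsOpen U → b ∈ U → ∀ᶠ i in l, ∀ x ∈ K, g i • x ∈ U := by
  obtain ⟨a, b, hab⟩ := exists_attracting_repelling hX hh hstab l hg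
  refine ⟨a, b, fun K hK hKa U hU hbU => ?_⟩
  by_contra hcon
  rw [← Ultrafilter.eventually_not] at hcon
  push Not at hcon
  obtain ⟨k, hk⟩ := hcon.choice
  obtain ⟨k', hk', hlim⟩ := hK.ultrafilter_le_nhds (l.map k) (by
    rw [le_principal_iff]
    exact hk.mono fun i hi => hi.1)
  have h₁ := hab k k' ((tendsto_nhds_iff_stronglyConverges hX hh).1 hlim) (hKa hk')
  have h₂ := (tendsto_nhds_iff_stronglyConverges hX hh).2 h₁
  obtain ⟨i, hi, hi'⟩ := ((h₂.eventually (hU.mem_nhds hbU)).and hk).exists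
  exact hi'.2 hi

end Action

/-- Pass to the subnet that corresponds to an ultrafilter. -/
theorem exists_collapsing_subnet {G : Type v} [Group G] {M : Type u} [TopologicalSpace M]
    [MulAction G M] {I : Type w} [Preorder I] [IsDirectedOrder I] [Nonempty I] (g : I → G)
    (l : Ultrafilter I) (hl : (l : Filter I) ≤ atTop) {a b : M}
    (hab : ∀ K : Set M, IsCompact K → K ⊆ {a}ᶜ → ∀ U, IsOpen U → b ∈ U →
      ∀ᶠ i in l, ∀ x ∈ K, g i • x ∈ U) :
    ∃ (J : Type w) (_ : Preorder J) (_ : IsDirectedOrder J) (_ : Nonempty J) (φ : J → I),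
      Monotone φ ∧ (∀ i, ∃ j, i ≤ φ j) ∧ IsCollapsing M (g ∘ φ) := by
  -- Pairs `(A, i)` with `i ∈ A ∈ l`, ordered by reverse inclusion and by `I`: beyond a pair with
  -- first entry `A`, every index lies in `A`. Directedness uses that `l` contains all tails.
  let J := {p : (Set I)ᵒᵈ × I // OrderDual.ofDual p.1 ∈ l ∧ p.2 ∈ OrderDual.ofDual p.1}
  let top : I → J := fun i => ⟨(OrderDual.toDual univ, i), Filter.univ_mem, mem_univ i⟩
  have hdir : IsDirectedOrder J := by
    refine ⟨fun p q => ?_⟩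
    have hmem : OrderDual.ofDual p.1.1 ∩ OrderDual.ofDual q.1.1 ∈ (l : Filter I) :=
      Filter.inter_mem p.2.1 q.2.1
    obtain ⟨i, ⟨hi, hpi⟩, hqi⟩ := (((eventually_mem_set.2 hmem).and
      (hl (eventually_ge_atTop p.1.2))).and (hl (eventually_ge_atTop q.1.2))).exists
    exact ⟨⟨(OrderDual.toDual _, i), hmem, hi⟩, ⟨inter_subset_left, hpi⟩,
      ⟨inter_subset_right, hqi⟩⟩
  refine ⟨J, inferInstance, hdir, ⟨top (Classical.arbitrary I)⟩, fun j => j.1.2,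
    fun p q h => h.2, fun i => ⟨top i, le_rfl⟩, a, b, fun K hK hKa U hU hbU => ?_⟩
  have hA := hab K hK hKa U hU hbU
  obtain ⟨i, hi⟩ := hA.exists
  refine ⟨⟨(OrderDual.toDual {i | ∀ x ∈ K, g i • x ∈ U}, i), hA, hi⟩, fun j hj => ?_⟩
  exact hj.1 j.2.2

end FineGraph

theorem mainTheorem8 {V : Type u} (X : SimpleGraph V)
    (hfine : FineGraph.IsFine X) (hhyp : FineGraph.IsHyperbolic X)
    (hcard : 3 ≤ ENat.card (FineGraph.BowditchCompactification X))
    {G : Type v} [Group G] [MulAction G V] [FineGraph.GraphAction G X]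
    (hstab : ∀ x y : V, X.Adj x y →
      Finite ↥(MulAction.stabilizer G x ⊓ MulAction.stabilizer G y)) :
    (∀ a : FineGraph.BowditchCompactification X,
      (𝓝 a).HasBasis (fun I : Set (Sym2 V) => I.Finite ∧ I ⊆ X.edgeSet)
        (FineGraph.avoidingSet X a)) ∧
    FineGraph.IsConvergenceAction.{u, v, w} G (FineGraph.BowditchCompactification X) := by
  refine ⟨FineGraph.hasBasis_nhds hfine hhyp, FineGraph.compactSpace hfine hhyp,
    FineGraph.t2Space hfine hhyp, hcard, FineGraph.continuousConstSMul hfine hhyp, ?_⟩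
  intro I _ _ _ g hg
  have hl := Ultrafilter.of_le (atTop : Filter I)
  obtain ⟨a, b, hab⟩ := FineGraph.eventually_smul_mem hfine hhyp hstab (Ultrafilter.of atTop)
    (g := g) fun x => hl (eventually_atTop.2 (hg x))
  exact FineGraph.exists_collapsing_subnet g _ hl hab
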